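/- Let $(\mathcal X,\Sigma)$ be a standard Borel space, let $\mathcal T$ be a set with a premetric $d:\mathcal T\times\mathcal T\to[0,1]$ (i.e. $d(t,t')=d(t',t)$ and $d(t,t)=0$), and let $X=(X_t)_{t\in\mathcal T}$ be an $\mathcal X$-valued stochastic process. Suppose that $(d,\mathcal T)$ is infinitely separable: there is a countable $\mathfrak T\subseteq\mathcal T$ such that for every $t\in\mathcal T$ there is a Cauchy sequence $(t_n)$ in $\mathfrak T$ (that is, $d(t_m,t_n)\to0$ as $m,n\to\infty$) with $d(t_n,t)\to 0$ and $\{t_n:n\in\mathbb N\}$ infinite. Suppose also that $X$ is locally exchangeable with respect to $d$: for every finite $S\subset\mathcal T$ and every injection $\pi:S\to\mathcal T$, $$\sup_{A}\left|\Pr\big((X_t)_{t\in S}\in A\big)-\Pr\big((X_{\pi(t)})_{t\in S}\in A\big)\right|\le\sum_{t\in S}d(t,\pi(t)),$$ where the supremum is over measurable $A\subseteq\mathcal X^S$. Let $T\subset\mathcal T$ be finite, write $X_T=(X_t)_{t\in T}$, let $\xi_t:\mathcal T\to[0,1]$ $(t\in T)$ satisfy $\sum_{t\in T}\xi_t(\sigma)=1$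 for all $\sigma\in\mathcal T$, and let $h:\mathcal X\to[0,1]$ be measurable. Put $$\widehat G_\tau=\sum_{t\in T}\xi_t(\tau)\,\delta_{X_t},\qquad \widehat G_\tau(h)=\int h\,d\widehat G_\tau,\qquad b_{h,t}(\tau)=\inf_{\hat h}\Big(|\hat h|\,d(t,\tau)+2\|h-\hat h\|_\infty\Big),$$ where the infimum is over all measurable simple functions $\hat h:\mathcal X\to[0,1]$ with finitely many levels, $\|\cdot\|_\infty$ is the supremum norm, and $|\hat h|$ is the sum of the distinct values taken by $\hat h$. Then for every $\tau\in\mathcal T\setminus T$, $$\mathbb E\Big[\big(\widehat G_\tau(h)-\mathbb E[h(X_\tau)\mid X_T]\big)^2\Big]\le\frac14\sum_{t\in T}\xi_t(\tau)^2+\sum_{t\in T}\xi_t(\tau)\,b_{h,t}(\tau),$$ and for every $\delta>0$, $$\Pr\Big(\big|\widehat G_\tau(h)-\mathbb E[h(X_\tau)\mid X_T]\big|>\delta\Big)\le\inf_{\epsilon\in(0,\delta)}\left\{2\exp\left(-\frac{2\epsilon^2}{\sum_{t\in T}\xi_t(\tau)^2}\right)+(\delta-\epsilon)^{-1}\sum_{t\in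 T}\xi_t(\tau)\,b_{h,t}(\tau)\right\}.$$ -/

import Mathlib

open MeasureTheory Filter Topology

namespace LocalExch

/-- A premetric with values in `[0, 1]`: symmetric and zero on the diagonal. -/
structure IsPremetric {𝒯 : Type*} (d : 𝒯 → 𝒯 → ℝ) : Prop where
  mem_Icc : ∀ s t, d s t ∈ Set.Icc (0 : ℝ) 1
  symm : ∀ s t, d s t = d t s
  self : ∀ t, d t t = 0

/-- `(d, 𝒯)` is infinitely separable: some countable subset `S` contains, for every `t`, a Cauchy
sequence that converges to `t` and takes infinitely many distinct values. -/
def InfinitelySeparable {𝒯 : Type*} (d : 𝒯 → 𝒯 → ℝ) : Prop :=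
  ∃ S : Set 𝒯, S.Countable ∧ ∀ t : 𝒯, ∃ s : ℕ → 𝒯,
    (∀ n, s n ∈ S) ∧
    (∀ ε > 0, ∃ N, ∀ m ≥ N, ∀ n ≥ N, d (s m) (s n) < ε) ∧
    Tendsto (fun n => d (s n) t) atTop (𝓝 0) ∧
    (Set.range s).Infinite

/-- Total variation distance `sup_A |μ A - ν A|` over measurable sets, for finite measures. -/
noncomputable def tvDist {E : Type*} [MeasurableSpace E] (μ ν : Measure E) : ℝ :=
  ⨆ A : {A : Set E // MeasurableSet A}, |μ.real A - ν.real A|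

/-- The process `X_{π,T}`, as a random element of `𝒳^T`: its coordinate at `t ∈ T` is `X_{π t}`. -/
def reindexed {Ω 𝒯 𝒳 : Type*} (X : 𝒯 → Ω → 𝒳) (T : Finset 𝒯) (π : T → 𝒯) (ω : Ω) : T → 𝒳 :=
  fun t => X (π t) ω

/-- The restriction `X_T`, as a random element of `𝒳^T`. -/
def restricted {Ω 𝒯 𝒳 : Type*} (X : 𝒯 → Ω → 𝒳) (T : Finset 𝒯) (ω : Ω) : T → 𝒳 :=
  fun t => X t ω

/-- `X` is locally exchangeable with respect to `d`. -/
def LocallyExchangeable {Ω 𝒯 𝒳 : Type*} [MeasurableSpace Ω] [MeasurableSpace 𝒳]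
    (P : Measure Ω) (X : 𝒯 → Ω → 𝒳) (d : 𝒯 → 𝒯 → ℝ) : Prop :=
  ∀ (T : Finset 𝒯) (π : T → 𝒯), Function.Injective π →
    tvDist (P.map (restricted X T)) (P.map (reindexed X T π)) ≤ ∑ t : T, d t (π t)

/-- The local empirical measure `∑_{t ∈ T} ξ_t(τ) δ_{X_t}` at `τ`. -/
noncomputable def localEmpirical {Ω 𝒯 𝒳 : Type*} [MeasurableSpace 𝒳]
    (X : 𝒯 → Ω → 𝒳) (T : Finset 𝒯) (ξ : 𝒯 → 𝒯 → ℝ) (τ : 𝒯) (ω : Ω) : Measure 𝒳 :=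
  ∑ t ∈ T, ENNReal.ofReal (ξ t τ) • Measure.dirac (X t ω)

/-- Simple functions with values in `[0, 1]`, with any finite number of levels. -/
abbrev UnitSimple (𝒳 : Type*) [MeasurableSpace 𝒳] : Type _ :=
  {g : SimpleFunc 𝒳 ℝ // ∀ x, g x ∈ Set.Icc (0 : ℝ) 1}

/-- The sum `|g|` of the levels of a simple function. -/
noncomputable def levelSum {𝒳 : Type*} [MeasurableSpace 𝒳] (g : SimpleFunc 𝒳 ℝ) : ℝ :=
  ∑ v ∈ g.range, v

/-- The coefficient
`b_{h,t}(τ) = inf_g (|g| d(t, τ) + 2 ‖h - g‖_∞)`, over simple functions `g : 𝒳 → [0, 1]`. -/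
noncomputable def biasCoeff {𝒯 𝒳 : Type*} [MeasurableSpace 𝒳] (d : 𝒯 → 𝒯 → ℝ) (h : 𝒳 → ℝ)
    (t τ : 𝒯) : ℝ :=
  ⨅ g : UnitSimple 𝒳, (levelSum g.1 * d t τ + 2 * ⨆ x, |h x - g.1 x|)

/-- The posterior predictive expectation `E[h(X_τ) | X_T]`. -/
noncomputable def posteriorPredictive {Ω 𝒯 𝒳 : Type*} [MeasurableSpace Ω] [MeasurableSpace 𝒳]
    (P : Measure Ω) (X : 𝒯 → Ω → 𝒳) (T : Finset 𝒯) (h : 𝒳 → ℝ) (τ : 𝒯) : Ω → ℝ :=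
  P[fun ω => h (X τ ω) | MeasurableSpace.comap (restricted X T) inferInstance]

end LocalExch

namespace LocalExch

/-! ### Total variation bounds -/

section TotalVariation

variable {E : Type*} [MeasurableSpace E]

/-! No directing measure is constructed; finite block averages take its place. Infinite separability
makes every ball infinite, so each index in `T ∪ {τ}` can head a block of `m + 1` indices, with all
blocks disjoint and all members extremely close to their heads. Local exchangeability then says that
swapping heads with members of their own blocks changes the joint law by at most a tiny `ρ`. Hence,
up to `ρ`, the heads may be treated as independent uniform draws from their blocks, and block
averages are invariant under these draws (`IsBlocking.abs_integral_sub_average_le`).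

Elementary facts about independent draws give the sampling error: a variance bound and Hoeffding's
lemma. The bias is the `L¹` distance between block averages at `t` and `τ`. To bound it, test their
difference against an approximate sign that ignores the heads. Then only the index `t` has to be
moved to `τ`, at cost `d t τ` (`integral_softSign_mul_sub_le`).

The weighted empirical mean is a function of `X_T`, so conditioning on `X_T` turns its error into
conditional expectations of sampling error and bias, minus a remainder small in `L¹`
(`exists_error_decomposition`). Conditional Jensen, Chernoff and Markov inequalities finish the
proof, with the slack sent to zero. -/

lemma abs_real_sub_le_tvDist (μ ν : Measure E) [IsProbabilityMeasure μ] [IsProbabilityMeasure ν]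
    {A : Set E} (hA : MeasurableSet A) : |μ.real A - ν.real A| ≤ tvDist μ ν := by
  refine le_ciSup (f := fun A : {A : Set E // MeasurableSet A} => |μ.real A - ν.real A|)
    ⟨1, ?_⟩ ⟨A, hA⟩
  rintro _ ⟨B, rfl⟩
  have h1 := measureReal_nonneg (μ := μ) (s := (B : Set E))
  have h2 := measureReal_nonneg (μ := ν) (s := (B : Set E))
  have h3 := measureReal_le_one (μ := μ) (s := (B : Set E))
  have h4 := measureReal_le_one (μ := ν) (s := (B : Set E))
  exact abs_le.2 ⟨by linarith, by linarith⟩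

lemma integrable_of_forall_mem_Icc {μ : Measure E} [IsFiniteMeasure μ] {f : E → ℝ} {a b : ℝ}
    (hf : Measurable f) (hab : ∀ x, f x ∈ Set.Icc a b) : Integrable f μ :=
  Integrable.of_mem_Icc a b hf.aemeasurable (ae_of_all _ hab)

/-- Layer-cake formula: each integral is the integral over `(0, M]` of the measures of superlevel
sets, and these differ by at most `tvDist` at every level. -/
lemma abs_integral_sub_le_of_nonneg (μ ν : Measure E) [IsProbabilityMeasure μ]
    [IsProbabilityMeasure ν] {f : E → ℝ} {M : ℝ} (hf : Measurable f) (hM : 0 ≤ M)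
    (hfM : ∀ x, f x ∈ Set.Icc 0 M) :
    |∫ x, f x ∂μ - ∫ x, f x ∂ν| ≤ M * tvDist μ ν := by
  have key : ∀ μ : Measure E, IsProbabilityMeasure μ →
      ∫ x, f x ∂μ = ∫ t in Set.Ioc 0 M, μ.real {x | t ≤ f x} := fun μ _ =>
    (integrable_of_forall_mem_Icc hf hfM).integral_eq_integral_Ioc_meas_le
      (ae_of_all _ fun x => (hfM x).1) (ae_of_all _ fun x => (hfM x).2)
  have hint : ∀ μ : Measure E, IsProbabilityMeasure μ →
      IntegrableOn (fun t : ℝ => μ.real {x | t ≤ f x}) (Set.Ioc 0 M) := fun μ _ => by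
    have hanti : Antitone fun t : ℝ => μ.real {x | t ≤ f x} := fun s t hst =>
      measureReal_mono fun x (hx : t ≤ f x) => hst.trans hx
    exact Integrable.of_mem_Icc 0 1 hanti.measurable.aemeasurable
      (ae_of_all _ fun t => ⟨measureReal_nonneg, measureReal_le_one⟩)
  rw [key μ inferInstance, key ν inferInstance,
    ← integral_sub (hint μ inferInstance) (hint ν inferInstance), ← Real.norm_eq_abs]
  refine (norm_setIntegral_le_of_norm_le_const (C := tvDist μ ν) (by simp) fun t _ => ?_).trans ?_
  · exact abs_real_sub_le_tvDist μ ν (measurableSet_le measurable_const hf)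
  · simp [hM, mul_comm]

lemma abs_integral_sub_le_tvDist (μ ν : Measure E) [IsProbabilityMeasure μ]
    [IsProbabilityMeasure ν] {f : E → ℝ} {a b : ℝ} (hf : Measurable f) (hab : a ≤ b)
    (hfab : ∀ x, f x ∈ Set.Icc a b) :
    |∫ x, f x ∂μ - ∫ x, f x ∂ν| ≤ (b - a) * tvDist μ ν := by
  have := abs_integral_sub_le_of_nonneg μ ν (f := fun x => f x - a) (M := b - a)
    (hf.sub_const a) (by linarith) fun x => ⟨by linarith [(hfab x).1], by linarith [(hfab x).2]⟩
  have hi : ∀ μ : Measure E, IsProbabilityMeasure μ → ∫ x, (f x - a) ∂μ = ∫ x, f x ∂μ - a :=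
    fun μ _ => by
      rw [integral_sub (integrable_of_forall_mem_Icc hf hfab) (integrable_const _)]; simp
  rwa [hi μ inferInstance, hi ν inferInstance, sub_sub_sub_cancel_right] at this

end TotalVariation

/-! ### Consequences of local exchangeability -/

section Exchange

variable {Ω 𝒯 𝒳 : Type*} [MeasurableSpace Ω] [MeasurableSpace 𝒳]
  {P : Measure Ω} [IsProbabilityMeasure P] {X : 𝒯 → Ω → 𝒳} {d : 𝒯 → 𝒯 → ℝ}

/-- The factor is the length of the range of `f`, not its sup norm; this keeps the final bias
constant sharp enough. -/
lemma LocallyExchangeable.abs_integral_sub_le (hloc : LocallyExchangeable P X d)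
    (hX : ∀ t, Measurable (X t)) {ι : Type*} [Fintype ι] {a b : ι → 𝒯}
    (ha : Function.Injective a) (hb : Function.Injective b)
    {f : (ι → 𝒳) → ℝ} (hf : Measurable f) {lo hi : ℝ} (hlohi : lo ≤ hi)
    (hfI : ∀ y, f y ∈ Set.Icc lo hi) :
    |∫ ω, f (fun i => X (a i) ω) ∂P - ∫ ω, f (fun i => X (b i) ω) ∂P|
      ≤ (hi - lo) * ∑ i, d (a i) (b i) := by
  classical
  let S : Finset 𝒯 := Finset.univ.map ⟨a, ha⟩
  have haS : ∀ i, a i ∈ S := fun i => Finset.mem_map.2 ⟨i, Finset.mem_univ _, rfl⟩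
  let u : ι ≃ S := Equiv.ofBijective (fun i => ⟨a i, haS i⟩)
    ⟨fun i j hij => ha (congrArg Subtype.val hij), fun s => by
      obtain ⟨i, -, hi⟩ := Finset.mem_map.1 s.2
      exact ⟨i, Subtype.ext hi⟩⟩
  let g : (S → 𝒳) → ℝ := fun y => f fun i => y (u i)
  have hg : Measurable g := hf.comp (measurable_pi_lambda _ fun i => measurable_pi_apply _)
  let π : S → 𝒯 := fun s => b (u.symm s)
  have hr : Measurable (restricted X S) := measurable_pi_lambda _ fun s => hX _
  have hri : Measurable (reindexed X S π) := measurable_pi_lambda _ fun s => hX _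
  have := Measure.isProbabilityMeasure_map (μ := P) hr.aemeasurable
  have := Measure.isProbabilityMeasure_map (μ := P) hri.aemeasurable
  have h1 := abs_integral_sub_le_tvDist (P.map (restricted X S)) (P.map (reindexed X S π)) hg
    hlohi fun y => hfI _
  rw [integral_map hr.aemeasurable hg.aestronglyMeasurable,
    integral_map hri.aemeasurable hg.aestronglyMeasurable] at h1
  have h2 := hloc S π (hb.comp u.symm.injective)
  have h3 : ∑ s : S, d s (π s) = ∑ i, d (a i) (b i) := by
    rw [← Equiv.sum_comp u]
    simp only [π, Equiv.symm_apply_apply]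
    rfl
  rw [h3] at h2
  have h4 : (fun ω => g (reindexed X S π ω)) = fun ω => f fun i => X (b i) ω := by
    funext ω
    simp only [g, reindexed, π, Equiv.symm_apply_apply]
  rw [h4] at h1
  exact h1.trans (mul_le_mul_of_nonneg_left h2 (by linarith))

/-- The reindexing of a family of blocks that exchanges, in block `t`, the entries `0` and `k t`. -/
def blockSwap {β : Type*} {m : ℕ} (k : β → Fin (m + 1)) (i : β × Fin (m + 1)) :
    β × Fin (m + 1) :=
  (i.1, Equiv.swap 0 (k i.1) i.2)

lemma blockSwap_injective {β : Type*} {m : ℕ} (k : β → Fin (m + 1)) :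
    Function.Injective (blockSwap k) := by
  rintro ⟨t, i⟩ ⟨s, j⟩ hij
  simp only [blockSwap, Prod.mk.injEq] at hij
  obtain ⟨rfl, h⟩ := hij
  rw [(Equiv.swap 0 (k t)).injective h]

/-- `e` arranges indices in disjoint blocks, in such a way that swapping the heads of the blocks
with other members of the same blocks changes laws by at most `ρ`. -/
structure IsBlocking {β : Type*} [Fintype β] (d : 𝒯 → 𝒯 → ℝ) (b : β → 𝒯) {m : ℕ} (ρ : ℝ)
    (e : β × Fin (m + 1) → 𝒯) : Prop where
  injective : Function.Injective e
  head : ∀ t, e (t, 0) = b t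
  cost : ∀ k, ∑ i, d (e i) (e (blockSwap k i)) ≤ ρ

/-- Averages over the choice of block members agree with the expectation, up to the swap cost. -/
lemma IsBlocking.abs_integral_sub_average_le (hloc : LocallyExchangeable P X d)
    (hX : ∀ t, Measurable (X t)) {β : Type*} [Fintype β] {b : β → 𝒯} {m : ℕ} {ρ : ℝ}
    {e : β × Fin (m + 1) → 𝒯} (he : IsBlocking d b ρ e)
    (Q : Measure (β → Fin (m + 1))) [IsProbabilityMeasure Q]
    {F : (β × Fin (m + 1) → 𝒳) → ℝ} (hF : Measurable F) {lo hi : ℝ} (hlohi : lo ≤ hi)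
    (hFI : ∀ y, F y ∈ Set.Icc lo hi) :
    |∫ ω, F (fun i => X (e i) ω) ∂P
      - ∫ ω, (∫ k, F (fun i => X (e (blockSwap k i)) ω) ∂Q) ∂P| ≤ (hi - lo) * ρ := by
  classical
  have hmeas : ∀ k : β → Fin (m + 1), Measurable fun ω => F (fun i => X (e (blockSwap k i)) ω) :=
    fun k => hF.comp (measurable_pi_lambda _ fun i => hX _)
  have hint : ∀ k, Integrable (fun ω => F (fun i => X (e (blockSwap k i)) ω)) P := fun k =>
    integrable_of_forall_mem_Icc (hmeas k) fun ω => hFI _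
  have h1 : ∫ ω, (∫ k, F (fun i => X (e (blockSwap k i)) ω) ∂Q) ∂P
      = ∫ k, (∫ ω, F (fun i => X (e (blockSwap k i)) ω) ∂P) ∂Q := by
    simp only [integral_fintype (Integrable.of_finite)]
    rw [integral_finsetSum _ fun k _ => (hint k).fun_smul _]
    exact Finset.sum_congr rfl fun k _ => integral_smul _ _
  have h2 : ∫ ω, F (fun i => X (e i) ω) ∂P
      = ∫ _, (∫ ω, F (fun i => X (e i) ω) ∂P) ∂Q := by simp
  rw [h1, h2, ← integral_sub Integrable.of_finite Integrable.of_finite, ← Real.norm_eq_abs]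
  refine (norm_integral_le_of_norm_le_const (C := (hi - lo) * ρ) (ae_of_all _ fun k => ?_)).trans
    (by simp)
  exact (hloc.abs_integral_sub_le hX he.injective (he.injective.comp (blockSwap_injective k)) hF
    hlohi hFI).trans (mul_le_mul_of_nonneg_left (he.cost k) (by linarith))

lemma InfinitelySeparable.infinite_setOf_lt (hsep : InfinitelySeparable d) (t : 𝒯) {ε : ℝ}
    (hε : 0 < ε) : {s | d s t < ε}.Infinite := by
  obtain ⟨_, -, h⟩ := hsep
  obtain ⟨s, -, -, hlim, hinf⟩ := h t
  obtain ⟨N, hN⟩ := eventually_atTop.1 (hlim.eventually (gt_mem_nhds hε))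
  refine (hinf.sdiff ((Set.finite_lt_nat N).image s)).mono ?_
  rintro _ ⟨⟨n, rfl⟩, hn⟩
  exact hN n (not_lt.1 fun hlt => hn ⟨n, hlt, rfl⟩)

/-- Hall's marriage theorem, applied to finite subsets of the `S i` with as many elements as `ι`:
any nonempty union is then already large enough. -/
lemma exists_injective_forall_mem_of_infinite {ι α : Type*} [Fintype ι] (S : ι → Set α)
    (hS : ∀ i, (S i).Infinite) : ∃ f : ι → α, Function.Injective f ∧ ∀ i, f i ∈ S i := by
  classical
  choose t htS ht using fun i => (hS i).exists_subset_card_eq (Fintype.card ι)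
  obtain ⟨f, hf, hft⟩ := (Finset.all_card_le_biUnion_card_iff_existsInjective' t).1 fun s => by
    rcases s.eq_empty_or_nonempty with rfl | ⟨i, hi⟩
    · simp
    · exact (Finset.card_le_univ s).trans
        ((ht i).symm.le.trans (Finset.card_le_card (Finset.subset_biUnion_of_mem t hi)))
  exact ⟨f, hf, fun i => htS i (hft i)⟩

lemma exists_isBlocking (hd : IsPremetric d) (hsep : InfinitelySeparable d) {β : Type*}
    [Fintype β] {b : β → 𝒯} (hb : Function.Injective b) (m : ℕ) {ρ : ℝ} (hρ : 0 < ρ) :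
    ∃ e : β × Fin (m + 1) → 𝒯, IsBlocking d b ρ e := by
  classical
  let n : ℝ := Fintype.card (β × Fin (m + 1))
  -- At most `n` swap costs, each at most `ε`, total at most `ρ`; the `+ 1` covers an empty index
  -- type.
  let ε : ℝ := ρ / (n + 1)
  have hn : 0 ≤ n := Nat.cast_nonneg _
  have hε : 0 < ε := by positivity
  obtain ⟨f, hf, hfS⟩ := exists_injective_forall_mem_of_infinite
    (fun i : β × Fin (m + 1) => {s | d s (b i.1) < ε} \ Set.range b)
    fun i => (hsep.infinite_setOf_lt (b i.1) hε).sdiff (Set.finite_range b)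
  let e : β × Fin (m + 1) → 𝒯 := fun i => if i.2 = 0 then b i.1 else f i
  have hlt : ∀ t j, d (e (t, j)) (b t) < ε := fun t j => by
    by_cases hj : j = 0
    · simpa [e, hj, hd.self] using hε
    · simpa [e, hj] using (hfS (t, j)).1
  refine ⟨e, ⟨?_, fun t => by simp [e], fun k => ?_⟩⟩
  · rintro ⟨t, i⟩ ⟨s, j⟩ hij
    by_cases hi : i = 0 <;> by_cases hj : j = 0 <;> simp only [e, hi, hj, if_true, if_false] at hij
    · rw [hb hij, hi, hj]
    · exact absurd ⟨t, hij⟩ (hfS (s, j)).2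
    · exact absurd ⟨s, hij.symm⟩ (hfS (t, i)).2
    · exact hf hij
  · have hle : ∀ i, d (e i) (e (blockSwap k i)) ≤ ε := by
      rintro ⟨t, j⟩
      simp only [blockSwap]
      by_cases hj : j = 0
      · rw [hj, Equiv.swap_apply_left, hd.symm]
        simpa [e] using (hlt t (k t)).le
      · by_cases hjk : j = k t
        · rw [hjk, Equiv.swap_apply_right]
          simpa [e] using (hlt t (k t)).le
        · rw [Equiv.swap_apply_of_ne_of_ne hj hjk, hd.self]
          exact hε.le
    refine (Finset.sum_le_sum fun i _ => hle i).trans ?_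
    rw [Finset.sum_const, nsmul_eq_mul, Finset.card_univ]
    change n * (ρ / (n + 1)) ≤ ρ
    rw [← mul_div_assoc, div_le_iff₀ (by positivity)]
    nlinarith

end Exchange

/-! ### Averages over independent uniform choices of block members -/

section BlockLaw

open ProbabilityTheory

variable {β : Type*} [Fintype β] {m : ℕ}

/-- The law of independent uniform choices of one member in each block. -/
noncomputable def blockLaw (β : Type*) [Fintype β] (m : ℕ) : Measure (β → Fin (m + 1)) :=
  Measure.pi fun _ => uniformOn Set.univ

instance : IsProbabilityMeasure (uniformOn (Set.univ : Set (Fin (m + 1)))) :=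
  isProbabilityMeasure_uniformOn Set.finite_univ Set.univ_nonempty

instance : IsProbabilityMeasure (blockLaw β m) := by
  unfold blockLaw; infer_instance

/-- The average over a block. -/
noncomputable def blockMean (z : Fin (m + 1) → ℝ) : ℝ := (∑ j, z j) / (m + 1)

lemma integral_uniformOn_fin (z : Fin (m + 1) → ℝ) :
    ∫ j, z j ∂(uniformOn (Set.univ : Set (Fin (m + 1)))) = blockMean z := by
  rw [integral_fintype Integrable.of_finite, blockMean, Finset.sum_div]
  refine Finset.sum_congr rfl fun j _ => ?_
  rw [measureReal_def, uniformOn_univ]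
  rw [Measure.count_singleton, Fintype.card_fin, ENNReal.toReal_div, ENNReal.toReal_natCast,
    ENNReal.toReal_one, smul_eq_mul, one_div, inv_mul_eq_div, Nat.cast_succ]

lemma integral_blockLaw_eval (z : Fin (m + 1) → ℝ) (t : β) :
    ∫ k, z (k t) ∂(blockLaw β m) = blockMean z := by
  rw [blockLaw, integral_comp_eval (μ := fun _ : β => uniformOn (Set.univ : Set (Fin (m + 1))))
    (i := t) (f := z) (measurable_of_finite z).aestronglyMeasurable, integral_uniformOn_fin]

lemma iIndepFun_blockLaw (z : β → Fin (m + 1) → ℝ) :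
    iIndepFun (fun t (k : β → Fin (m + 1)) => z t (k t)) (blockLaw β m) :=
  iIndepFun_pi (X := z) fun t => (measurable_of_finite (z t)).aemeasurable

/-- Bias-variance decomposition around `c`. Variances add by independence, and a variable in `[0,
1]` has variance at most `1 / 4`. -/
lemma integral_sq_blockLaw_le (w : β → ℝ) (z : β → Fin (m + 1) → ℝ)
    (hz : ∀ t j, z t j ∈ Set.Icc (0 : ℝ) 1) (c : ℝ) :
    ∫ k, (∑ t, w t * z t (k t) - c) ^ 2 ∂(blockLaw β m)
      ≤ 1 / 4 * ∑ t, w t ^ 2 + (∑ t, w t * blockMean (z t) - c) ^ 2 := by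
  classical
  have hL : ∀ f : (β → Fin (m + 1)) → ℝ, MemLp f 2 (blockLaw β m) := fun f => .of_discrete
  have hmean : ∫ k, ∑ t, w t * z t (k t) ∂(blockLaw β m) = ∑ t, w t * blockMean (z t) := by
    rw [integral_finsetSum _ fun t _ => Integrable.of_finite]
    simp only [integral_const_mul, integral_blockLaw_eval]
  have hvar : Var[fun k => ∑ t, w t * z t (k t); blockLaw β m] ≤ 1 / 4 * ∑ t, w t ^ 2 := by
    have h1 := IndepFun.variance_sum (X := fun t (k : β → Fin (m + 1)) => w t * z t (k t))
      (s := Finset.univ) (μ := blockLaw β m) (fun t _ => hL _) fun s _ t _ hst =>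
        (iIndepFun_blockLaw fun t j => w t * z t j).indepFun hst
    have h2 : (∑ t, fun k : β → Fin (m + 1) => w t * z t (k t))
        = fun k => ∑ t, w t * z t (k t) := by
      funext k; simp
    rw [h2] at h1
    rw [h1, Finset.mul_sum]
    refine Finset.sum_le_sum fun t _ => ?_
    rw [variance_const_mul]
    have := variance_le_sq_of_bounded (μ := blockLaw β m) (a := 0) (b := 1)
      (X := fun k => z t (k t)) (ae_of_all _ fun k => hz t _) (measurable_of_finite _).aemeasurable
    nlinarith [sq_nonneg (w t)]
  have h3 : Var[fun k => ∑ t, w t * z t (k t); blockLaw β m]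
      = ∫ k, (∑ t, w t * z t (k t) - c) ^ 2 ∂(blockLaw β m)
        - (∑ t, w t * blockMean (z t) - c) ^ 2 := by
    rw [← variance_sub_const (measurable_of_finite _).aestronglyMeasurable c,
      variance_eq_sub (hL _)]
    congr 2
    rw [integral_sub Integrable.of_finite (integrable_const _), hmean]
    simp
  linarith

/-- Hoeffding's lemma: a summand ranging over an interval of length `w t` is sub-Gaussian with proxy
`(w t / 2) ^ 2`, and proxies add by independence. -/
lemma integral_exp_blockLaw_le (w : β → ℝ) (hw : ∀ t, 0 ≤ w t) (z : β → Fin (m + 1) → ℝ)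
    (hz : ∀ t j, z t j ∈ Set.Icc (0 : ℝ) 1) (l : ℝ) :
    ∫ k, Real.exp (l * ∑ t, w t * (z t (k t) - blockMean (z t))) ∂(blockLaw β m)
      ≤ Real.exp (l ^ 2 * (∑ t, w t ^ 2) / 8) := by
  classical
  have h1 : ∀ t ∈ (Finset.univ : Finset β),
      HasSubgaussianMGF (fun k : β → Fin (m + 1) => w t * (z t (k t) - blockMean (z t)))
        ((‖w t - 0‖₊ / 2) ^ 2) (blockLaw β m) := fun t _ => by
    have := hasSubgaussianMGF_of_mem_Icc (μ := blockLaw β m) (a := 0) (b := w t)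
      (X := fun k => w t * z t (k t)) (measurable_of_finite _).aemeasurable
      (ae_of_all _ fun k => ⟨mul_nonneg (hw t) (hz t _).1,
        mul_le_of_le_one_right (hw t) (hz t _).2⟩)
    simpa only [integral_const_mul, integral_blockLaw_eval, mul_sub] using this
  have h2 := (HasSubgaussianMGF.sum_of_iIndepFun
    (iIndepFun_blockLaw fun t j => w t * (z t j - blockMean (z t))) h1).mgf_le l
  refine h2.trans_eq ?_
  congr 1
  push_cast
  simp only [sub_zero, Real.norm_eq_abs, div_pow, sq_abs, ← Finset.sum_div]
  ring

end BlockLaw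

/-! ### Properties of block averages -/

section BlockMean

variable {m : ℕ}

lemma blockMean_mem_Icc {z : Fin (m + 1) → ℝ} {a b : ℝ} (hz : ∀ j, z j ∈ Set.Icc a b) :
    blockMean z ∈ Set.Icc a b := by
  have hm : (0 : ℝ) < m + 1 := by positivity
  rw [blockMean, Set.mem_Icc, le_div_iff₀ hm, div_le_iff₀ hm]
  constructor
  · have := Finset.sum_le_sum fun j (_ : j ∈ Finset.univ) => (hz j).1
    simp at this
    linarith
  · have := Finset.sum_le_sum fun j (_ : j ∈ Finset.univ) => (hz j).2
    simp at this
    linarith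

lemma blockMean_sub (z z' : Fin (m + 1) → ℝ) :
    blockMean z - blockMean z' = blockMean fun j => z j - z' j := by
  simp only [blockMean, Finset.sum_sub_distrib, sub_div]

/-- A swap only permutes the block. This invariance lets block means be held fixed while heads are
redrawn. -/
lemma blockMean_comp_blockSwap {β 𝒳 : Type*} (g : 𝒳 → ℝ) (y : β × Fin (m + 1) → 𝒳)
    (k : β → Fin (m + 1)) (t : β) :
    (blockMean fun j => g (y (blockSwap k (t, j)))) = blockMean fun j => g (y (t, j)) := by
  unfold blockMean
  congr 1
  exact Equiv.sum_comp (Equiv.swap 0 (k t)) fun j => g (y (t, j))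

lemma measurable_blockMean {E : Type*} [MeasurableSpace E] {z : E → Fin (m + 1) → ℝ}
    (hz : ∀ j, Measurable fun x => z x j) : Measurable fun x => blockMean (z x) :=
  (Finset.measurable_sum _ fun j _ => hz j).div_const _

end BlockMean

/-! ### A Lipschitz approximation of the sign function -/

/-- The odd function that is linear on `[-κ, κ]` and equal to the sign outside. -/
noncomputable def softSign (κ x : ℝ) : ℝ := max (-1) (min 1 (x / κ))

lemma softSign_mem_Icc (κ x : ℝ) : softSign κ x ∈ Set.Icc (-1 : ℝ) 1 :=
  ⟨le_max_left _ _, max_le (by norm_num) (min_le_left _ _)⟩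

lemma measurable_softSign (κ : ℝ) : Measurable (softSign κ) :=
  measurable_const.max (measurable_const.min (measurable_id.div_const κ))

lemma abs_le_add_mul_softSign {κ : ℝ} (hκ : 0 < κ) (x : ℝ) : |x| ≤ κ + x * softSign κ x := by
  rcases le_total κ |x| with h | h
  · rcases abs_cases x with ⟨hx, h0⟩ | ⟨hx, h0⟩
    · have h1 : 1 ≤ x / κ := by rw [le_div_iff₀ hκ]; linarith
      rw [softSign, min_eq_left h1, max_eq_right (by norm_num)]
      linarith
    · have h1 : x / κ ≤ -1 := by rw [div_le_iff₀ hκ]; linarith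
      rw [softSign, min_eq_right (by linarith), max_eq_left h1]
      linarith
  · have h2 : 0 ≤ x * softSign κ x := by
      rcases le_total 0 x with h0 | h0
      · exact mul_nonneg h0 (le_max_of_le_right (le_min (by norm_num) (div_nonneg h0 hκ.le)))
      · exact mul_nonneg_of_nonpos_of_nonpos h0
          (max_le (by norm_num) ((min_le_right _ _).trans (div_nonpos_of_nonpos_of_nonneg h0 hκ.le)))
    linarith

/-- The reason for not using the true sign: deleting the heads from two block averages moves their
difference by at most `1 / (m + 1)`, which a Lipschitz function tolerates. -/
lemma abs_softSign_sub_le {κ : ℝ} (hκ : 0 < κ) (x y : ℝ) :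
    |softSign κ x - softSign κ y| ≤ |x - y| / κ := by
  rw [softSign, softSign, max_comm (-1), max_comm (-1)]
  refine (abs_max_sub_max_le_abs _ _ _).trans
    ((abs_min_sub_min_le_max 1 (x / κ) 1 (y / κ)).trans_eq ?_)
  rw [sub_self, abs_zero, max_eq_right (abs_nonneg _), ← sub_div, abs_div, abs_of_pos hκ]

/-! ### Estimates for block averages of a locally exchangeable process -/

section Estimates

variable {Ω 𝒯 𝒳 β : Type*} {X : 𝒯 → Ω → 𝒳} {m : ℕ} {e : β × Fin (m + 1) → 𝒯} {g h : 𝒳 → ℝ}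

/-- The average of `g` over the block of `t`. -/
noncomputable def blockAvg (X : 𝒯 → Ω → 𝒳) (e : β × Fin (m + 1) → 𝒯) (g : 𝒳 → ℝ) (t : β)
    (ω : Ω) : ℝ :=
  blockMean fun j => g (X (e (t, j)) ω)

lemma blockAvg_mem_Icc {lo hi : ℝ} (hg : ∀ x, g x ∈ Set.Icc lo hi) (t : β) (ω : Ω) :
    blockAvg X e g t ω ∈ Set.Icc lo hi :=
  blockMean_mem_Icc fun _ => hg _

variable [MeasurableSpace Ω] [MeasurableSpace 𝒳]

lemma measurable_blockAvg (hX : ∀ t, Measurable (X t)) (hg : Measurable g) (t : β) :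
    Measurable (blockAvg X e g t) :=
  measurable_blockMean fun _ => hg.comp (hX _)

variable {P : Measure Ω} [IsProbabilityMeasure P] {d : 𝒯 → 𝒯 → ℝ} [Fintype β] {b : β → 𝒯} {ρ : ℝ}

/-- The sign factor sees only non-head members, so the two terms differ by moving the single index
`b t` to `b s` while every other index stays in place. -/
lemma integral_softSign_mul_sub_le (hd : IsPremetric d) (hloc : LocallyExchangeable P X d)
    (hX : ∀ t, Measurable (X t)) (he : IsBlocking d b ρ e) (hg : Measurable g) {M : ℝ}
    (hM : 0 ≤ M) (hgM : ∀ x, g x ∈ Set.Icc 0 M) (κ : ℝ)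
    {D : (β × Fin m → 𝒳) → ℝ} (hD : Measurable D) (t s : β) :
    ∫ ω, softSign κ (D fun i => X (e (i.1, i.2.succ)) ω) * (g (X (b t) ω) - g (X (b s) ω)) ∂P
      ≤ M * d (b t) (b s) := by
  let a : β → Option (β × Fin m) → 𝒯 := fun r o => o.elim (e (r, 0)) fun i => e (i.1, i.2.succ)
  have ha : ∀ r, Function.Injective (a r) := fun r => by
    rintro (_ | ⟨p, i⟩) (_ | ⟨q, j⟩) hij
    · rfl
    · have := congrArg Prod.snd (he.injective hij)
      exact absurd this.symm (Fin.succ_ne_zero _)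
    · have := congrArg Prod.snd (he.injective hij)
      exact absurd this (Fin.succ_ne_zero _)
    · have := he.injective hij
      simp only [Prod.mk.injEq, Fin.succ_inj] at this
      rw [this.1, this.2]
  let φ : (Option (β × Fin m) → 𝒳) → ℝ := fun y => softSign κ (D fun i => y (some i))
  have hφ : Measurable φ := (measurable_softSign κ).comp
    (hD.comp (measurable_pi_lambda _ fun i => measurable_pi_apply _))
  -- The added term cancels in the difference, and it brings the range from `[-M, M]` into `[0, M]`,
  -- saving a factor `2`.
  let f : (Option (β × Fin m) → 𝒳) → ℝ := fun y => φ y * g (y none) + M * (1 - φ y) / 2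
  have hf : Measurable f := (hφ.mul (hg.comp (measurable_pi_apply _))).add
    (((hφ.const_sub 1).const_mul M).div_const 2)
  have hfI : ∀ y, f y ∈ Set.Icc 0 M := fun y => by
    obtain ⟨h1, h2⟩ := softSign_mem_Icc κ (D fun i => y (some i))
    obtain ⟨h3, h4⟩ := hgM (y none)
    change -1 ≤ φ y at h1
    change φ y ≤ 1 at h2
    constructor <;> simp only [f] <;> nlinarith
  have key := hloc.abs_integral_sub_le hX (ha t) (ha s) hf hM hfI
  simp only [Fintype.sum_option, a, Option.elim_none, Option.elim_some, he.head, hd.self,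
    Finset.sum_const_zero, add_zero, sub_zero] at key
  refine (le_of_eq ?_).trans ((le_abs_self _).trans key)
  have hint : ∀ r, Integrable (fun ω => f fun i => X (a r i) ω) P := fun r =>
    integrable_of_forall_mem_Icc (a := 0) (b := M)
      (hf.comp (measurable_pi_lambda _ fun i => hX _)) fun ω => hfI fun i => X (a r i) ω
  have h1 := integral_sub (hint t) (hint s)
  simp only [a] at h1
  rw [← he.head t, ← he.head s]
  rw [← he.head t, ← he.head s] at key
  refine Eq.trans (integral_congr_ae (ae_of_all _ fun ω => ?_)) h1
  simp only [f, φ, Option.elim_none, Option.elim_some]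
  ring

/-- The three error terms come from replacing the absolute value by `softSign`, from deleting the
heads inside it, and from redrawing heads for a function with range of length `2`. -/
lemma IsBlocking.integral_abs_blockAvg_sub_le_of_le (he : IsBlocking d b ρ e) (hd : IsPremetric d)
    (hloc : LocallyExchangeable P X d) (hX : ∀ t, Measurable (X t)) (hg : Measurable g)
    (hg1 : ∀ x, g x ∈ Set.Icc (0 : ℝ) 1) {M : ℝ} (hM : 0 ≤ M) (hgM : ∀ x, g x ≤ M)
    {κ : ℝ} (hκ : 0 < κ) (t s : β) :
    ∫ ω, |blockAvg X e g t ω - blockAvg X e g s ω| ∂P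
      ≤ M * d (b t) (b s) + (κ + 1 / ((m + 1) * κ) + 2 * ρ) := by
  have hm : (0 : ℝ) < m + 1 := by positivity
  let D : (β × Fin (m + 1) → 𝒳) → ℝ := fun y =>
    (blockMean fun j => g (y (t, j))) - blockMean fun j => g (y (s, j))
  have hDm : Measurable D :=
    (measurable_blockMean fun j => hg.comp (measurable_pi_apply _)).sub
      (measurable_blockMean fun j => hg.comp (measurable_pi_apply _))
  let Y : Ω → β × Fin (m + 1) → 𝒳 := fun ω i => X (e i) ω
  have hY : Measurable Y := measurable_pi_lambda _ fun i => hX _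
  let F : (β × Fin (m + 1) → 𝒳) → ℝ := fun y => softSign κ (D y) * (g (y (t, 0)) - g (y (s, 0)))
  have hF : Measurable F := ((measurable_softSign κ).comp hDm).mul
    ((hg.comp (measurable_pi_apply _)).sub (hg.comp (measurable_pi_apply _)))
  have hmul : ∀ {u v : ℝ}, u ∈ Set.Icc (-1 : ℝ) 1 → v ∈ Set.Icc (-1 : ℝ) 1 →
      u * v ∈ Set.Icc (-1 : ℝ) 1 := fun {u v} hu hv => by
    rw [Set.mem_Icc, ← abs_le] at *
    rw [abs_mul]
    exact mul_le_one₀ hu (abs_nonneg _) hv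
  have hsub : ∀ {u v : ℝ}, u ∈ Set.Icc (0 : ℝ) 1 → v ∈ Set.Icc (0 : ℝ) 1 →
      u - v ∈ Set.Icc (-1 : ℝ) 1 := fun {u v} hu hv =>
    ⟨by linarith [hu.1, hv.2], by linarith [hu.2, hv.1]⟩
  have hDI : ∀ y, D y ∈ Set.Icc (-1 : ℝ) 1 := fun y =>
    hsub (blockMean_mem_Icc fun _ => hg1 _) (blockMean_mem_Icc fun _ => hg1 _)
  have hFI : ∀ y, F y ∈ Set.Icc (-1 : ℝ) 1 := fun y =>
    hmul (softSign_mem_Icc _ _) (hsub (hg1 _) (hg1 _))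
  have hDφI : ∀ y, D y * softSign κ (D y) ∈ Set.Icc (-1 : ℝ) 1 := fun y =>
    hmul (hDI y) (softSign_mem_Icc _ _)
  have hint : Integrable (fun ω => D (Y ω) * softSign κ (D (Y ω))) P :=
    integrable_of_forall_mem_Icc
      ((hDm.mul ((measurable_softSign κ).comp hDm)).comp hY) fun ω => hDφI _
  have h1 : ∫ ω, |D (Y ω)| ∂P ≤ κ + ∫ ω, D (Y ω) * softSign κ (D (Y ω)) ∂P := by
    have : ∫ ω, (κ + D (Y ω) * softSign κ (D (Y ω))) ∂P
        = κ + ∫ ω, D (Y ω) * softSign κ (D (Y ω)) ∂P := by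
      rw [integral_add (integrable_const _) hint]; simp
    rw [← this]
    exact integral_mono (integrable_of_forall_mem_Icc (hDm.comp hY) fun ω => hDI _).abs
      ((integrable_const _).add hint) fun ω => abs_le_add_mul_softSign hκ _
  have h2 := he.abs_integral_sub_average_le hloc hX (blockLaw β m) hF (by norm_num) hFI
  -- `D` is unchanged by swaps, so averaging over the heads turns their difference back into `D`.
  have h3 : ∀ ω, ∫ k, F (fun i => X (e (blockSwap k i)) ω) ∂(blockLaw β m)
      = D (Y ω) * softSign κ (D (Y ω)) := fun ω => by
    have hDk : ∀ k, D (fun i => X (e (blockSwap k i)) ω) = D (Y ω) := fun k => by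
      simp only [D]
      rw [blockMean_comp_blockSwap g (Y ω) k t, blockMean_comp_blockSwap g (Y ω) k s]
    simp only [F, hDk]
    simp only [blockSwap, Equiv.swap_apply_left]
    rw [integral_const_mul, integral_sub Integrable.of_finite Integrable.of_finite,
      integral_blockLaw_eval (fun j => g (X (e (t, j)) ω)),
      integral_blockLaw_eval (fun j => g (X (e (s, j)) ω)), mul_comm]
  simp only [h3] at h2
  have h4 : ∫ ω, D (Y ω) * softSign κ (D (Y ω)) ∂P ≤ ∫ ω, F (Y ω) ∂P + 2 * ρ := by
    have := (abs_le.1 h2).1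
    change _ ≤ ∫ ω, F (Y ω) ∂P - _ at this
    linarith
  -- The heads are dropped but the divisor stays `m + 1`, so `D - D'` is exactly the head difference
  -- over `m + 1`.
  let D' : (β × Fin m → 𝒳) → ℝ := fun y => (∑ j, g (y (t, j)) - ∑ j, g (y (s, j))) / (m + 1)
  have hD' : Measurable D' :=
    ((Finset.measurable_sum _ fun j _ => hg.comp (measurable_pi_apply _)).sub
      (Finset.measurable_sum _ fun j _ => hg.comp (measurable_pi_apply _))).div_const _
  let Y' : Ω → β × Fin m → 𝒳 := fun ω i => X (e (i.1, i.2.succ)) ω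
  have hY' : Measurable Y' := measurable_pi_lambda _ fun i => hX _
  have h5 := integral_softSign_mul_sub_le hd hloc hX he hg hM (fun x => ⟨(hg1 x).1, hgM x⟩) κ hD' t s
  have h6 : ∀ ω, F (Y ω) ≤ softSign κ (D' (Y' ω)) * (g (X (b t) ω) - g (X (b s) ω))
      + 1 / ((m + 1) * κ) := fun ω => by
    simp only [F, Y, he.head]
    have hΔ := hsub (hg1 (X (b t) ω)) (hg1 (X (b s) ω))
    rw [Set.mem_Icc, ← abs_le] at hΔ
    set Δ := g (X (b t) ω) - g (X (b s) ω) with hΔdef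
    have hDD' : D (Y ω) - D' (Y' ω) = Δ / (m + 1) := by
      simp only [D, D', Y, Y', blockMean, Fin.sum_univ_succ, he.head, hΔdef]
      ring
    have h7 := abs_softSign_sub_le hκ (D (Y ω)) (D' (Y' ω))
    rw [hDD', abs_div, abs_of_pos hm] at h7
    have h8 : |softSign κ (D (Y ω)) - softSign κ (D' (Y' ω))| ≤ 1 / ((m + 1) * κ) := by
      refine h7.trans ?_
      rw [div_div]
      gcongr
    have h9 := le_abs_self ((softSign κ (D (Y ω)) - softSign κ (D' (Y' ω))) * Δ)
    rw [abs_mul] at h9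
    have h10 := mul_le_of_le_one_right
      (abs_nonneg (softSign κ (D (Y ω)) - softSign κ (D' (Y' ω)))) hΔ
    change softSign κ (D (Y ω)) * Δ ≤ _
    linarith
  have hint' : Integrable
      (fun ω => softSign κ (D' (Y' ω)) * (g (X (b t) ω) - g (X (b s) ω))) P :=
    integrable_of_forall_mem_Icc (((measurable_softSign κ).comp (hD'.comp hY')).mul
      ((hg.comp (hX _)).sub (hg.comp (hX _)))) fun ω =>
        hmul (softSign_mem_Icc _ _) (hsub (hg1 _) (hg1 _))
  have h7 : ∫ ω, F (Y ω) ∂P ≤ M * d (b t) (b s) + 1 / ((m + 1) * κ) := by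
    refine (integral_mono (integrable_of_forall_mem_Icc (hF.comp hY) fun ω => hFI _)
      (hint'.add (integrable_const _)) h6).trans ?_
    rw [integral_add' hint' (integrable_const _)]
    simpa using h5
  change ∫ ω, |D (Y ω)| ∂P ≤ _
  linarith

/-- Replacing `h` by a simple `g` costs the sup norm once per block. The levels of `g` are
nonnegative, so their sum bounds `g` and can serve as `M`. -/
lemma IsBlocking.integral_abs_blockAvg_sub_le (he : IsBlocking d b ρ e) (hd : IsPremetric d)
    (hloc : LocallyExchangeable P X d) (hX : ∀ t, Measurable (X t)) (hh : Measurable h)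
    (hh1 : ∀ x, h x ∈ Set.Icc (0 : ℝ) 1) {κ : ℝ} (hκ : 0 < κ) (t s : β) :
    ∫ ω, |blockAvg X e h t ω - blockAvg X e h s ω| ∂P
      ≤ biasCoeff d h (b t) (b s) + (κ + 1 / ((m + 1) * κ) + 2 * ρ) := by
  rw [← sub_le_iff_le_add]
  have : Nonempty (UnitSimple 𝒳) := ⟨⟨0, fun x => by simp⟩⟩
  refine le_ciInf fun g => ?_
  rw [sub_le_iff_le_add]
  have hgm : Measurable g.1 := g.1.measurable
  have hbdd : BddAbove (Set.range fun x => |h x - g.1 x|) := ⟨1, by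
    rintro _ ⟨x, rfl⟩
    have h1 := hh1 x
    have h2 := g.2 x
    exact abs_le.2 ⟨by linarith [h1.1, h2.2], by linarith [h1.2, h2.1]⟩⟩
  have hnonneg : ∀ v ∈ g.1.range, 0 ≤ v := fun v hv => by
    obtain ⟨x, rfl⟩ := SimpleFunc.mem_range.1 hv
    exact (g.2 x).1
  have hle : ∀ x, g.1 x ≤ levelSum g.1 := fun x =>
    Finset.single_le_sum hnonneg (SimpleFunc.mem_range_self g.1 x)
  have h1 := he.integral_abs_blockAvg_sub_le_of_le hd hloc hX hgm g.2
    (Finset.sum_nonneg hnonneg) hle hκ t s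
  have h2 : ∀ r ω, |blockAvg X e h r ω - blockAvg X e g.1 r ω| ≤ ⨆ x, |h x - g.1 x| :=
    fun r ω => by
      rw [blockAvg, blockAvg, blockMean_sub, abs_le, ← Set.mem_Icc]
      exact blockMean_mem_Icc fun j => abs_le.1 (le_ciSup hbdd (X (e (r, j)) ω))
  have hint : ∀ {f : 𝒳 → ℝ}, Measurable f → (∀ x, f x ∈ Set.Icc (0 : ℝ) 1) →
      Integrable (fun ω => |blockAvg X e f t ω - blockAvg X e f s ω|) P := fun hf hf1 =>
    ((integrable_of_forall_mem_Icc (measurable_blockAvg hX hf t)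
      fun ω => blockAvg_mem_Icc hf1 t ω).sub
      (integrable_of_forall_mem_Icc (measurable_blockAvg hX hf s)
        fun ω => blockAvg_mem_Icc hf1 s ω)).abs
  have h3 : ∫ ω, |blockAvg X e h t ω - blockAvg X e h s ω| ∂P
      ≤ ∫ ω, (|blockAvg X e g.1 t ω - blockAvg X e g.1 s ω| + 2 * ⨆ x, |h x - g.1 x|) ∂P := by
    refine integral_mono (hint hh hh1) ((hint hgm g.2).add (integrable_const _)) fun ω => ?_
    have h4 := abs_le.1 (h2 t ω)
    have h5 := abs_le.1 (h2 s ω)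
    have h6 := abs_le.1 (le_refl |blockAvg X e g.1 t ω - blockAvg X e g.1 s ω|)
    exact abs_le.2 ⟨by linarith, by linarith⟩
  rw [integral_add (hint hgm g.2) (integrable_const _)] at h3
  simp only [integral_const, probReal_univ, smul_eq_mul, one_mul] at h3
  rw [levelSum]
  linarith

end Estimates

/-! ### Sampling error, by redrawing the block heads -/

section Concentration

variable {Ω 𝒯 𝒳 β : Type*} [MeasurableSpace Ω] [MeasurableSpace 𝒳] {P : Measure Ω}
  [IsProbabilityMeasure P] {X : 𝒯 → Ω → 𝒳} {d : 𝒯 → 𝒯 → ℝ} [Fintype β] {m : ℕ} {h : 𝒳 → ℝ} {ρ : ℝ}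

lemma sum_mul_mem_Icc {w z : β → ℝ} {lo hi : ℝ} (hw : ∀ t, 0 ≤ w t) (hw1 : ∑ t, w t = 1)
    (hz : ∀ t, z t ∈ Set.Icc lo hi) : ∑ t, w t * z t ∈ Set.Icc lo hi := by
  constructor
  · calc lo = ∑ t, w t * lo := by rw [← Finset.sum_mul, hw1, one_mul]
      _ ≤ _ := Finset.sum_le_sum fun t _ => mul_le_mul_of_nonneg_left (hz t).1 (hw t)
  · calc ∑ t, w t * z t ≤ ∑ t, w t * hi :=
        Finset.sum_le_sum fun t _ => mul_le_mul_of_nonneg_left (hz t).2 (hw t)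
      _ = hi := by rw [← Finset.sum_mul, hw1, one_mul]

lemma sub_mem_Icc_neg_one_one {u v : ℝ} (hu : u ∈ Set.Icc (0 : ℝ) 1) (hv : v ∈ Set.Icc (0 : ℝ) 1) :
    u - v ∈ Set.Icc (-1 : ℝ) 1 :=
  ⟨by linarith [hu.1, hv.2], by linarith [hu.2, hv.1]⟩

lemma sq_mem_Icc_of_mem_Icc {u : ℝ} (hu : u ∈ Set.Icc (-1 : ℝ) 1) : u ^ 2 ∈ Set.Icc (0 : ℝ) 1 :=
  ⟨sq_nonneg u, by nlinarith [hu.1, hu.2]⟩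

/-- A deviation bounded by `1` dominates its own square; hence the bias enters the mean-square bound
linearly. -/
lemma sq_sum_mul_sub_le {w z : β → ℝ} {c : ℝ} (hw : ∀ t, 0 ≤ w t) (hw1 : ∑ t, w t = 1)
    (hz : ∀ t, z t ∈ Set.Icc (0 : ℝ) 1) (hc : c ∈ Set.Icc (0 : ℝ) 1) :
    (∑ t, w t * z t - c) ^ 2 ≤ ∑ t, w t * |z t - c| := by
  have h1 : ∑ t, w t * z t - c = ∑ t, w t * (z t - c) := by
    simp only [mul_sub, Finset.sum_sub_distrib, ← Finset.sum_mul, hw1, one_mul]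
  have h2 : |∑ t, w t * z t - c| ≤ 1 :=
    abs_le.2 (sub_mem_Icc_neg_one_one (sum_mul_mem_Icc hw hw1 hz) hc)
  calc (∑ t, w t * z t - c) ^ 2 ≤ |∑ t, w t * z t - c| := by
        rw [← sq_abs]
        nlinarith [abs_nonneg (∑ t, w t * z t - c)]
    _ ≤ _ := by
        rw [h1]
        refine (Finset.abs_sum_le_sum_abs _ _).trans_eq (Finset.sum_congr rfl fun t _ => ?_)
        rw [abs_mul, abs_of_nonneg (hw t)]

lemma IsBlocking.integral_sq_sub_blockAvg_le {b : β → 𝒯} {e : β × Fin (m + 1) → 𝒯}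
    (he : IsBlocking d b ρ e) (hloc : LocallyExchangeable P X d) (hX : ∀ t, Measurable (X t))
    (hh : Measurable h) (hh1 : ∀ x, h x ∈ Set.Icc (0 : ℝ) 1) {w : β → ℝ} (hw : ∀ t, 0 ≤ w t)
    (hw1 : ∑ t, w t = 1) (s : β) :
    ∫ ω, (∑ t, w t * h (X (b t) ω) - blockAvg X e h s ω) ^ 2 ∂P
      ≤ 1 / 4 * ∑ t, w t ^ 2
        + ∑ t, w t * ∫ ω, |blockAvg X e h t ω - blockAvg X e h s ω| ∂P + ρ := by
  let F : (β × Fin (m + 1) → 𝒳) → ℝ := fun y =>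
    (∑ t, w t * h (y (t, 0)) - blockMean fun j => h (y (s, j))) ^ 2
  have hF : Measurable F := ((Finset.measurable_sum _ fun t _ =>
    (hh.comp (measurable_pi_apply _)).const_mul _).sub
      (measurable_blockMean fun j => hh.comp (measurable_pi_apply _))).pow_const 2
  have hFI : ∀ y, F y ∈ Set.Icc (0 : ℝ) 1 := fun y => sq_mem_Icc_of_mem_Icc
    (sub_mem_Icc_neg_one_one (sum_mul_mem_Icc hw hw1 fun t => hh1 _)
      (blockMean_mem_Icc fun j => hh1 _))
  have h1 := he.abs_integral_sub_average_le hloc hX (blockLaw β m) hF zero_le_one hFI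
  have h2 : ∀ ω, ∫ k, F (fun i => X (e (blockSwap k i)) ω) ∂(blockLaw β m)
      ≤ 1 / 4 * ∑ t, w t ^ 2 + ∑ t, w t * |blockAvg X e h t ω - blockAvg X e h s ω| := fun ω => by
    have h3 := integral_sq_blockLaw_le w (fun t j => h (X (e (t, j)) ω)) (fun t j => hh1 _)
      (blockAvg X e h s ω)
    have h4 : ∀ k, (blockMean fun j => h (X (e (blockSwap k (s, j))) ω)) = blockAvg X e h s ω :=
      fun k => blockMean_comp_blockSwap h (fun i => X (e i) ω) k s
    simp only [F, h4]
    simp only [blockSwap, Equiv.swap_apply_left]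
    exact h3.trans (add_le_add le_rfl (sq_sum_mul_sub_le hw hw1
      (fun t => blockAvg_mem_Icc hh1 t ω) (blockAvg_mem_Icc hh1 s ω)))
  have hint : ∀ t, Integrable (fun ω => |blockAvg X e h t ω - blockAvg X e h s ω|) P := fun t =>
    (integrable_of_forall_mem_Icc ((measurable_blockAvg hX hh t).sub (measurable_blockAvg hX hh s))
      fun ω => sub_mem_Icc_neg_one_one (blockAvg_mem_Icc hh1 t ω) (blockAvg_mem_Icc hh1 s ω)).abs
  have hint2 : Integrable
      (fun ω => ∑ t, w t * |blockAvg X e h t ω - blockAvg X e h s ω|) P :=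
    integrable_finsetSum _ fun t _ => (hint t).const_mul _
  have h3 : ∫ ω, (∫ k, F (fun i => X (e (blockSwap k i)) ω) ∂(blockLaw β m)) ∂P
      ≤ ∫ ω, (1 / 4 * ∑ t, w t ^ 2
        + ∑ t, w t * |blockAvg X e h t ω - blockAvg X e h s ω|) ∂P :=
    integral_mono_of_nonneg (ae_of_all _ fun ω => integral_nonneg fun k =>
      (hFI fun i => X (e (blockSwap k i)) ω).1)
      ((integrable_const _).add hint2) (ae_of_all _ h2)
  rw [integral_add (integrable_const _) hint2,
    integral_finsetSum _ fun t _ => (hint t).const_mul _] at h3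
  simp only [integral_const, probReal_univ, smul_eq_mul, one_mul, integral_const_mul] at h3
  have h4 := (abs_le.1 h1).2
  simp only [F, he.head] at h4 h3
  change ∫ ω, (∑ t, w t * h (X (b t) ω) - blockAvg X e h s ω) ^ 2 ∂P - _ ≤ _ at h4
  linarith

lemma IsBlocking.integral_exp_sub_blockAvg_le {b : β → 𝒯} {e : β × Fin (m + 1) → 𝒯}
    (he : IsBlocking d b ρ e) (hloc : LocallyExchangeable P X d) (hX : ∀ t, Measurable (X t))
    (hh : Measurable h) (hh1 : ∀ x, h x ∈ Set.Icc (0 : ℝ) 1) {w : β → ℝ} (hw : ∀ t, 0 ≤ w t)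
    (hw1 : ∑ t, w t = 1) (l : ℝ) :
    ∫ ω, Real.exp (l * ∑ t, w t * (h (X (b t) ω) - blockAvg X e h t ω)) ∂P
      ≤ Real.exp (l ^ 2 * (∑ t, w t ^ 2) / 8) + Real.exp |l| * ρ := by
  let F : (β × Fin (m + 1) → 𝒳) → ℝ := fun y =>
    Real.exp (l * ∑ t, w t * (h (y (t, 0)) - blockMean fun j => h (y (t, j))))
  have hF : Measurable F := Real.measurable_exp.comp ((Finset.measurable_sum _ fun t _ =>
    ((hh.comp (measurable_pi_apply _)).sub
      (measurable_blockMean fun j => hh.comp (measurable_pi_apply _))).const_mul _).const_mul l)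
  have hFI : ∀ y, F y ∈ Set.Icc (0 : ℝ) (Real.exp |l|) := fun y => by
    refine ⟨(Real.exp_pos _).le, Real.exp_le_exp.2 ((le_abs_self _).trans ?_)⟩
    rw [abs_mul]
    exact mul_le_of_le_one_right (abs_nonneg _) (abs_le.2 (sum_mul_mem_Icc hw hw1 fun t =>
      sub_mem_Icc_neg_one_one (hh1 _) (blockMean_mem_Icc fun j => hh1 _)))
  have h1 := he.abs_integral_sub_average_le hloc hX (blockLaw β m) hF (Real.exp_pos _).le hFI
  have h2 : ∀ ω, ∫ k, F (fun i => X (e (blockSwap k i)) ω) ∂(blockLaw β m)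
      ≤ Real.exp (l ^ 2 * (∑ t, w t ^ 2) / 8) := fun ω => by
    have h3 := integral_exp_blockLaw_le w hw (fun t j => h (X (e (t, j)) ω)) (fun t j => hh1 _) l
    have h4 : ∀ k t, (blockMean fun j => h (X (e (blockSwap k (t, j))) ω))
        = blockMean fun j => h (X (e (t, j)) ω) :=
      fun k t => blockMean_comp_blockSwap h (fun i => X (e i) ω) k t
    simp only [F, h4]
    simpa only [blockSwap, Equiv.swap_apply_left] using h3
  have h3 := integral_mono_of_nonneg (μ := P)
    (ae_of_all _ fun ω => integral_nonneg (μ := blockLaw β m) fun k =>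
      (hFI fun i => X (e (blockSwap k i)) ω).1)
    (integrable_const _) (ae_of_all _ h2)
  simp only [integral_const, probReal_univ, smul_eq_mul, one_mul] at h3
  have h4 := (abs_le.1 h1).2
  simp only [F, he.head] at h4 h3
  change ∫ ω, Real.exp (l * ∑ t, w t * (h (X (b t) ω) - blockAvg X e h t ω)) ∂P - _ ≤ _ at h4
  linarith

open ProbabilityTheory in
lemma IsBlocking.abs_integral_mul_sub_blockAvg_le {b : Option β → 𝒯}
    {e : Option β × Fin (m + 1) → 𝒯} (he : IsBlocking d b ρ e) (hloc : LocallyExchangeable P X d)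
    (hX : ∀ t, Measurable (X t)) (hh : Measurable h) (hh1 : ∀ x, h x ∈ Set.Icc (0 : ℝ) 1)
    {p : (β → 𝒳) → ℝ} (hp : Measurable p) (hp1 : ∀ y, p y ∈ Set.Icc (-1 : ℝ) 1) :
    |∫ ω, p (fun t => X (b (some t)) ω) * (h (X (b none) ω) - blockAvg X e h none ω) ∂P|
      ≤ 2 * ρ := by
  classical
  let F : (Option β × Fin (m + 1) → 𝒳) → ℝ := fun y => p (fun t => y (some t, 0)) * h (y (none, 0))
  have hmul : ∀ {u v : ℝ}, u ∈ Set.Icc (-1 : ℝ) 1 → v ∈ Set.Icc (0 : ℝ) 1 →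
      u * v ∈ Set.Icc (-1 : ℝ) 1 := fun {u v} hu hv =>
    ⟨by nlinarith [hu.1, hu.2, hv.1, hv.2], by nlinarith [hu.1, hu.2, hv.1, hv.2]⟩
  have hpY : Measurable fun ω => p (fun t => X (b (some t)) ω) :=
    hp.comp (measurable_pi_lambda _ fun t => hX _)
  have hF : Measurable F := (hp.comp (measurable_pi_lambda _ fun t => measurable_pi_apply _)).mul
    (hh.comp (measurable_pi_apply _))
  have hFI : ∀ y, F y ∈ Set.Icc (-1 : ℝ) 1 := fun y => hmul (hp1 _) (hh1 _)
  -- Only the head of the block `none` is redrawn, so the factor `p` is left untouched.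
  let u : Fin (m + 1) → Option β → Fin (m + 1) := fun j => Function.update (fun _ => 0) none j
  let Q : Measure (Option β → Fin (m + 1)) := (uniformOn Set.univ).map u
  have : IsProbabilityMeasure Q :=
    Measure.isProbabilityMeasure_map (measurable_of_finite u).aemeasurable
  have h1 := he.abs_integral_sub_average_le hloc hX Q hF (by norm_num) hFI
  have h2 : ∀ ω, ∫ k, F (fun i => X (e (blockSwap k i)) ω) ∂Q
      = p (fun t => X (b (some t)) ω) * blockAvg X e h none ω := fun ω => by
    rw [integral_map (measurable_of_finite u).aemeasurable
      (measurable_of_finite _).aestronglyMeasurable]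
    simp only [F, blockSwap, u, Equiv.swap_apply_left, Function.update_self, he.head,
      Function.update_of_ne (Option.some_ne_none _)]
    rw [integral_const_mul, integral_uniformOn_fin]
    rfl
  simp only [h2] at h1
  simp only [F, he.head] at h1
  have hi1 : Integrable (fun ω => p (fun t => X (b (some t)) ω) * h (X (b none) ω)) P :=
    integrable_of_forall_mem_Icc (hpY.mul (hh.comp (hX _))) fun ω => hmul (hp1 _) (hh1 _)
  have hi2 : Integrable (fun ω => p (fun t => X (b (some t)) ω) * blockAvg X e h none ω) P :=
    integrable_of_forall_mem_Icc (hpY.mul (measurable_blockAvg hX hh none)) fun ω =>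
      hmul (hp1 _) (blockAvg_mem_Icc hh1 none ω)
  rw [← integral_sub hi1 hi2] at h1
  simp only [← mul_sub] at h1
  linarith

end Concentration

/-! ### Conditional expectations -/

section CondExp

variable {Ω E : Type*} {mΩ : MeasurableSpace Ω} [mE : MeasurableSpace E] {P : Measure Ω}
  [IsProbabilityMeasure P]

/-- `L¹` duality: the extremal test function is the sign of the conditional expectation, which
factors through `Y`. -/
lemma integral_abs_condExp_comap_le {Y : Ω → E} (hY : Measurable Y) {Z : Ω → ℝ}
    (hZ : Integrable Z P) {c : ℝ}
    (hc : ∀ p : E → ℝ, Measurable p → (∀ y, p y ∈ Set.Icc (-1 : ℝ) 1) →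
      ∫ ω, p (Y ω) * Z ω ∂P ≤ c) :
    ∫ ω, |(P[Z | mE.comap Y]) ω| ∂P ≤ c := by
  have hm : mE.comap Y ≤ mΩ := hY.comap_le
  obtain ⟨q, hq, hqY⟩ := (stronglyMeasurable_condExp (m := mE.comap Y) (μ := P)
    (f := Z)).measurable.exists_eq_measurable_comp
  let p : E → ℝ := fun y => if 0 ≤ q y then 1 else -1
  have hp : Measurable p :=
    Measurable.ite (measurableSet_le measurable_const hq) measurable_const measurable_const
  have hp1 : ∀ y, p y ∈ Set.Icc (-1 : ℝ) 1 := fun y => by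
    simp only [p]; split_ifs <;> norm_num
  have hpY : StronglyMeasurable[mE.comap Y] fun ω => p (Y ω) :=
    (hp.comp (comap_measurable Y)).stronglyMeasurable
  have h1 := condExp_stronglyMeasurable_mul_of_bound hm hpY hZ 1
    (ae_of_all _ fun ω => abs_le.2 (hp1 _))
  have h2 : ∀ ω, |(P[Z | mE.comap Y]) ω| = p (Y ω) * (P[Z | mE.comap Y]) ω := fun ω => by
    rw [hqY]
    simp only [Function.comp, p]
    split_ifs with h
    · rw [abs_of_nonneg h, one_mul]
    · rw [abs_of_neg (not_le.1 h)]; ring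
  simp only [h2]
  refine le_trans (le_of_eq ?_) (hc p hp hp1)
  rw [← integral_condExp hm (f := fun ω => p (Y ω) * Z ω)]
  exact (integral_congr_ae h1).symm

lemma integral_comp_condExp_le {𝓖 : MeasurableSpace Ω} (h𝓖 : 𝓖 ≤ mΩ) {Z : Ω → ℝ} {φ : ℝ → ℝ}
    (hφ : ConvexOn ℝ Set.univ φ) (hφc : Continuous φ) {a b : ℝ} (hZ : Measurable[mΩ] Z)
    (hZI : ∀ ω, Z ω ∈ Set.Icc a b) :
    Integrable (fun ω => φ ((P[Z | 𝓖]) ω)) P ∧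
      ∫ ω, φ ((P[Z | 𝓖]) ω) ∂P ≤ ∫ ω, φ (Z ω) ∂P := by
  have hZi : Integrable Z P := Integrable.of_mem_Icc a b hZ.aemeasurable (ae_of_all _ hZI)
  obtain ⟨C, hC⟩ := isCompact_Icc.exists_bound_of_continuousOn (s := Set.Icc a b) hφc.continuousOn
  have hφZ : Integrable (φ ∘ Z) P := Integrable.of_bound
    (hφc.measurable.comp hZ).aestronglyMeasurable C (ae_of_all _ fun ω => hC _ (hZI ω))
  have hI : ∀ᵐ ω ∂P, (P[Z | 𝓖]) ω ∈ Set.Icc a b :=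
    (convex_Icc a b).condExp_mem h𝓖 hZi isClosed_Icc (ae_of_all _ hZI)
  have hφE : Integrable (fun ω => φ ((P[Z | 𝓖]) ω)) P := Integrable.of_bound
    (hφc.comp_aestronglyMeasurable (stronglyMeasurable_condExp.mono h𝓖).aestronglyMeasurable) C
    (hI.mono fun ω hω => hC _ hω)
  refine ⟨hφE, ?_⟩
  have h1 := hφ.map_condExp_le_univ h𝓖 hφc.lowerSemicontinuous hZi hφZ
  refine (integral_mono_ae hφE integrable_condExp h1).trans_eq ?_
  exact integral_condExp h𝓖

/-- Chernoff's bound; conditional Jensen removes the conditioning from the exponential moment. -/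
lemma measureReal_ge_condExp_le {𝓖 : MeasurableSpace Ω} (h𝓖 : 𝓖 ≤ mΩ) {Z : Ω → ℝ}
    (hZ : Measurable[mΩ] Z) {a b : ℝ} (hZI : ∀ ω, Z ω ∈ Set.Icc a b) {l : ℝ} (hl : 0 ≤ l)
    (ε : ℝ) :
    P.real {ω | ε ≤ (P[Z | 𝓖]) ω} ≤ Real.exp (-(l * ε)) * ∫ ω, Real.exp (l * Z ω) ∂P := by
  have hconv : ConvexOn ℝ Set.univ fun x : ℝ => Real.exp (l * x) := 
    convexOn_exp.comp_linearMap (LinearMap.mulLeft ℝ l)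
  obtain ⟨hi, hle⟩ := integral_comp_condExp_le (P := P) h𝓖 hconv (by fun_prop) hZ hZI
  have h1 := mul_meas_ge_le_integral_of_nonneg (ae_of_all P fun ω =>
    (Real.exp_pos (l * (P[Z | 𝓖]) ω)).le) hi (Real.exp (l * ε))
  have h2 : P.real {ω | ε ≤ (P[Z | 𝓖]) ω}
      ≤ P.real {ω | Real.exp (l * ε) ≤ Real.exp (l * (P[Z | 𝓖]) ω)} :=
    measureReal_mono fun ω (hω : ε ≤ _) =>
      Real.exp_le_exp.2 (mul_le_mul_of_nonneg_left hω hl)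
  have h3 := Real.exp_pos (-(l * ε))
  calc P.real {ω | ε ≤ (P[Z | 𝓖]) ω}
      ≤ Real.exp (-(l * ε)) * (Real.exp (l * ε)
          * P.real {ω | Real.exp (l * ε) ≤ Real.exp (l * (P[Z | 𝓖]) ω)}) := by
        rw [← mul_assoc, ← Real.exp_add, neg_add_cancel, Real.exp_zero, one_mul]
        exact h2
    _ ≤ _ := mul_le_mul_of_nonneg_left (h1.trans hle) h3.le

end CondExp

/-! ### Error decomposition and the two final bounds -/

section Approximation

variable {Ω 𝒯 𝒳 : Type*} [MeasurableSpace 𝒳] {X : 𝒯 → Ω → 𝒳} {h : 𝒳 → ℝ}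

lemma integral_localEmpirical (hh : Measurable h) {T : Finset 𝒯} {ξ : 𝒯 → 𝒯 → ℝ}
    {τ : 𝒯} (hξ : ∀ t ∈ T, 0 ≤ ξ t τ) (ω : Ω) :
    ∫ x, h x ∂(localEmpirical X T ξ τ ω) = ∑ t : T, ξ t τ * h (X t ω) := by
  rw [localEmpirical, integral_finsetSum_measure fun t _ =>
    (integrable_dirac' hh.stronglyMeasurable (by simp)).smul_measure ENNReal.ofReal_ne_top]
  rw [← Finset.sum_coe_sort T]
  refine Finset.sum_congr rfl fun t _ => ?_
  rw [integral_smul_measure, integral_dirac' _ _ hh.stronglyMeasurable,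
    ENNReal.toReal_ofReal (hξ t t.2), smul_eq_mul]

variable [MeasurableSpace Ω] {P : Measure Ω} [IsProbabilityMeasure P] {d : 𝒯 → 𝒯 → ℝ}

lemma measurable_restricted (hX : ∀ t, Measurable (X t)) (T : Finset 𝒯) :
    Measurable (restricted X T) :=
  measurable_pi_lambda _ fun _ => hX _

/-- The error of the weighted empirical mean `∑ w_t h(X_t)` as an estimator of the posterior
predictive expectation is the conditional expectation of a sampling error `A` and of a bias `B`,
up to a remainder `C` that is small in `L¹`. -/
lemma exists_error_decomposition (hd : IsPremetric d) (hsep : InfinitelySeparable d)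
    (hloc : LocallyExchangeable P X d) (hX : ∀ t, Measurable (X t)) (hh : Measurable h)
    (hh1 : ∀ x, h x ∈ Set.Icc (0 : ℝ) 1) {T : Finset 𝒯} {τ : 𝒯} (hτ : τ ∉ T) {w : T → ℝ}
    (hw : ∀ t, 0 ≤ w t) (hw1 : ∑ t, w t = 1) (l : ℝ) {η : ℝ} (hη : 0 < η) :
    ∃ A B C : Ω → ℝ, Measurable A ∧ Measurable B ∧ Integrable C P ∧
      (∀ ω, A ω ∈ Set.Icc (-1 : ℝ) 1) ∧ (∀ ω, B ω ∈ Set.Icc (-1 : ℝ) 1) ∧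
      (∀ ω, A ω + B ω ∈ Set.Icc (-1 : ℝ) 1) ∧
      (∀ᵐ ω ∂P, ∑ t, w t * h (X t ω) - posteriorPredictive P X T h τ ω
        = (P[A | MeasurableSpace.comap (restricted X T) inferInstance]) ω
          + (P[B | MeasurableSpace.comap (restricted X T) inferInstance]) ω - C ω) ∧
      ∫ ω, (A ω + B ω) ^ 2 ∂P ≤ 1 / 4 * ∑ t, w t ^ 2 + ∑ t, w t * biasCoeff d h t τ + η ∧
      ∫ ω, |B ω| ∂P ≤ ∑ t, w t * biasCoeff d h t τ + η ∧
      ∫ ω, |C ω| ∂P ≤ η ∧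
      ∫ ω, Real.exp (l * A ω) ∂P ≤ Real.exp (l ^ 2 * (∑ t, w t ^ 2) / 8) + η ∧
      ∫ ω, Real.exp (-l * A ω) ∂P ≤ Real.exp (l ^ 2 * (∑ t, w t ^ 2) / 8) + η := by
  let b : Option T → 𝒯 := fun o => o.elim τ fun t => t
  have hb : Function.Injective b := by
    rintro (_ | t) (_ | s) hts
    · rfl
    · exact absurd ((show τ = (s : 𝒯) from hts) ▸ s.2) hτ
    · exact absurd ((show (t : 𝒯) = τ from hts) ▸ t.2) hτ
    · exact congrArg some (Subtype.ext hts)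
  -- The block of `τ` gets weight `0`: it serves only as the target.
  let v : Option T → ℝ := fun o => o.elim 0 w
  have hv : ∀ o, 0 ≤ v o := by
    rintro (_ | t)
    · exact le_rfl
    · exact hw t
  have hvsum : ∀ f : Option T → ℝ, ∑ o, v o * f o = ∑ t, w t * f (some t) := fun f => by
    simp [Fintype.sum_option, v]
  have hv1 : ∑ o, v o = 1 := by simpa [Fintype.sum_option, v] using hw1
  have hv2 : ∑ o, v o ^ 2 = ∑ t, w t ^ 2 := by simp [Fintype.sum_option, v]
  -- With this `κ`, `m` large and `ρ ≤ η / 8`, the bias error `κ + 1 / ((m + 1) * κ) + 2 * ρ` is at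
  -- most `3 / 4 * η`, leaving room for one more `ρ`.
  let κ : ℝ := η / 4
  have hκ : 0 < κ := by positivity
  obtain ⟨m, hm⟩ := exists_nat_gt (1 / (κ * κ))
  have hmκ : 1 / ((m + 1) * κ) ≤ η / 4 := by
    rw [div_lt_iff₀ (by positivity)] at hm
    change 1 / ((m + 1) * κ) ≤ κ
    rw [div_le_iff₀ (by positivity)]
    nlinarith [mul_pos hκ hκ]
  let ρ : ℝ := η / (8 * Real.exp |l|)
  have hρ : 0 < ρ := by positivity
  have hρl : Real.exp |l| * ρ = η / 8 := by
    have := (Real.exp_pos |l|).ne'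
    simp only [ρ]
    field_simp
  have hρη : ρ ≤ η / 8 := by
    rw [← hρl]
    exact le_mul_of_one_le_left hρ.le (Real.one_le_exp (abs_nonneg l))
  obtain ⟨e, he⟩ := exists_isBlocking hd hsep hb m hρ
  let G : Option T → Ω → ℝ := blockAvg X e h
  have hG : ∀ o, Measurable (G o) := fun o => measurable_blockAvg hX hh o
  have hG1 : ∀ o ω, G o ω ∈ Set.Icc (0 : ℝ) 1 := fun o ω => blockAvg_mem_Icc hh1 o ω
  have hbias : ∀ t : T, ∫ ω, |G (some t) ω - G none ω| ∂P ≤ biasCoeff d h t τ + 3 / 4 * η :=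
    fun t => by
      have := he.integral_abs_blockAvg_sub_le hd hloc hX hh hh1 hκ (some t) none
      change ∫ ω, |G (some t) ω - G none ω| ∂P ≤ biasCoeff d h t τ + _ at this
      have hκη : κ = η / 4 := rfl
      linarith
  have hbsum : ∑ t, w t * ∫ ω, |G (some t) ω - G none ω| ∂P
      ≤ ∑ t, w t * biasCoeff d h t τ + 3 / 4 * η := by
    calc _ ≤ ∑ t, w t * (biasCoeff d h t τ + 3 / 4 * η) :=
          Finset.sum_le_sum fun t _ => mul_le_mul_of_nonneg_left (hbias t) (hw t)
      _ = _ := by simp only [mul_add, Finset.sum_add_distrib, ← Finset.sum_mul, hw1, one_mul]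
  let A : Ω → ℝ := fun ω => ∑ t, w t * (h (X t ω) - G (some t) ω)
  let B : Ω → ℝ := fun ω => ∑ t, w t * (G (some t) ω - G none ω)
  have hA : Measurable A := Finset.measurable_sum _ fun t _ =>
    ((hh.comp (hX _)).sub (hG _)).const_mul _
  have hB : Measurable B := Finset.measurable_sum _ fun t _ => ((hG _).sub (hG _)).const_mul _
  have hA1 : ∀ ω, A ω ∈ Set.Icc (-1 : ℝ) 1 := fun ω =>
    sum_mul_mem_Icc hw hw1 fun t => sub_mem_Icc_neg_one_one (hh1 _) (hG1 _ _)
  have hB1 : ∀ ω, B ω ∈ Set.Icc (-1 : ℝ) 1 := fun ω =>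
    sum_mul_mem_Icc hw hw1 fun t => sub_mem_Icc_neg_one_one (hG1 _ _) (hG1 _ _)
  have hAB : ∀ ω, A ω + B ω = ∑ t, w t * h (X t ω) - G none ω := fun ω => by
    simp only [A, B, mul_sub, Finset.sum_sub_distrib, ← Finset.sum_mul, hw1, one_mul]
    ring
  have hm𝓖 := (measurable_restricted hX T).comap_le
  have hhτ : Integrable (fun ω => h (X τ ω)) P :=
    integrable_of_forall_mem_Icc (hh.comp (hX τ)) fun ω => hh1 _
  have hGτ : Integrable (G none) P := integrable_of_forall_mem_Icc (hG none) (hG1 none)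
  have hAi : Integrable A P := integrable_of_forall_mem_Icc hA hA1
  have hBi : Integrable B P := integrable_of_forall_mem_Icc hB hB1
  refine ⟨A, B, P[(fun ω => h (X τ ω) - G none ω) |
    MeasurableSpace.comap (restricted X T) inferInstance], hA, hB, integrable_condExp, hA1, hB1,
    fun ω => ?_, ?_, ?_, ?_, ?_, ?_, ?_⟩
  · rw [hAB]
    exact sub_mem_Icc_neg_one_one (sum_mul_mem_Icc hw hw1 fun t => hh1 _) (hG1 _ _)
  · have hS : StronglyMeasurable[MeasurableSpace.comap (restricted X T) inferInstance]
        fun ω => ∑ t, w t * h (X t ω) := by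
      have : Measurable fun y : T → 𝒳 => ∑ t, w t * h (y t) :=
        Finset.measurable_sum _ fun t _ => (hh.comp (measurable_pi_apply t)).const_mul _
      exact (this.comp (comap_measurable (restricted X T))).stronglyMeasurable
    have hSi : Integrable (fun ω => ∑ t, w t * h (X t ω)) P :=
      integrable_finsetSum _ fun t _ => (integrable_of_forall_mem_Icc (hh.comp (hX _))
        fun _ => hh1 _).const_mul _
    have h1 := condExp_add hAi hBi (MeasurableSpace.comap (restricted X T) inferInstance)
    have h2 := condExp_sub hSi hGτ (MeasurableSpace.comap (restricted X T) inferInstance)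
    have h3 := condExp_sub hhτ hGτ (MeasurableSpace.comap (restricted X T) inferInstance)
    have h4 : A + B = (fun ω => ∑ t, w t * h (X t ω)) - G none := funext hAB
    rw [h4] at h1
    rw [condExp_of_stronglyMeasurable hm𝓖 hS hSi] at h2
    filter_upwards [h1, h2, h3] with ω h1 h2 h3
    change (P[(fun ω => h (X τ ω) - G none ω) | _]) ω = _ at h3
    rw [h3]
    simp only [Pi.add_apply, Pi.sub_apply] at h1 h2 ⊢
    rw [← h1, h2, posteriorPredictive]
    ring
  · have h1 := he.integral_sq_sub_blockAvg_le hloc hX hh hh1 hv hv1 none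
    simp only [hvsum, hv2] at h1
    simp only [hAB]
    change ∫ ω, (∑ t, w t * h (X t ω) - G none ω) ^ 2 ∂P
      ≤ _ + ∑ t, w t * (∫ ω, |G (some t) ω - G none ω| ∂P) + ρ at h1
    linarith
  · have hGi : ∀ t : T, Integrable (fun ω => |G (some t) ω - G none ω|) P := fun t =>
      ((integrable_of_forall_mem_Icc (hG _) (hG1 _)).sub hGτ).abs
    have h1 : ∫ ω, |B ω| ∂P ≤ ∫ ω, ∑ t, w t * |G (some t) ω - G none ω| ∂P := by
      refine integral_mono hBi.abs (integrable_finsetSum _ fun t _ => (hGi t).const_mul _)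
        fun ω => ?_
      refine (Finset.abs_sum_le_sum_abs _ _).trans_eq (Finset.sum_congr rfl fun t _ => ?_)
      rw [abs_mul, abs_of_nonneg (hw t)]
    rw [integral_finsetSum _ fun t _ => (hGi t).const_mul _] at h1
    simp only [integral_const_mul] at h1
    linarith
  · refine integral_abs_condExp_comap_le (measurable_restricted hX T) (hhτ.sub hGτ)
      fun p hp hp1 => ?_
    have := (le_abs_self _).trans (he.abs_integral_mul_sub_blockAvg_le hloc hX hh hh1 hp hp1)
    change ∫ ω, p (restricted X T ω) * (h (X τ ω) - G none ω) ∂P ≤ 2 * ρ at this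
    exact this.trans (by linarith)
  · have h1 := he.integral_exp_sub_blockAvg_le hloc hX hh hh1 hv hv1 l
    simp only [hvsum, hv2] at h1
    refine h1.trans ?_
    rw [hρl]
    linarith
  · have h1 := he.integral_exp_sub_blockAvg_le hloc hX hh hh1 hv hv1 (-l)
    simp only [hvsum, hv2, abs_neg, neg_sq] at h1
    refine h1.trans ?_
    rw [hρl]
    linarith

lemma posteriorPredictive_mem_Icc (hX : ∀ t, Measurable (X t)) (hh : Measurable h)
    (hh1 : ∀ x, h x ∈ Set.Icc (0 : ℝ) 1) (T : Finset 𝒯) (τ : 𝒯) :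
    ∀ᵐ ω ∂P, posteriorPredictive P X T h τ ω ∈ Set.Icc (0 : ℝ) 1 :=
  (convex_Icc 0 1).condExp_mem (measurable_restricted hX T).comap_le
    (integrable_of_forall_mem_Icc (hh.comp (hX τ)) fun _ => hh1 _) isClosed_Icc
    (ae_of_all _ fun _ => hh1 _)

lemma integrable_sq_error (hX : ∀ t, Measurable (X t)) (hh : Measurable h)
    (hh1 : ∀ x, h x ∈ Set.Icc (0 : ℝ) 1) {T : Finset 𝒯} (τ : 𝒯) {w : T → ℝ}
    (hw : ∀ t, 0 ≤ w t) (hw1 : ∑ t, w t = 1) :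
    Integrable (fun ω => (∑ t, w t * h (X t ω) - posteriorPredictive P X T h τ ω) ^ 2) P := by
  have h1 : Measurable fun ω => ∑ t, w t * h (X t ω) :=
    Finset.measurable_sum _ fun t _ => (hh.comp (hX _)).const_mul _
  have h2 : Measurable (posteriorPredictive P X T h τ) :=
    (stronglyMeasurable_condExp.mono (measurable_restricted hX T).comap_le).measurable
  refine Integrable.of_mem_Icc 0 1 ((h1.sub h2).pow_const 2).aemeasurable ?_
  filter_upwards [posteriorPredictive_mem_Icc (P := P) hX hh hh1 T τ] with ω hω
  exact sq_mem_Icc_of_mem_Icc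
    (sub_mem_Icc_neg_one_one (sum_mul_mem_Icc hw hw1 fun t => hh1 _) hω)

theorem integral_sq_error_le (hd : IsPremetric d) (hsep : InfinitelySeparable d)
    (hloc : LocallyExchangeable P X d) (hX : ∀ t, Measurable (X t)) (hh : Measurable h)
    (hh1 : ∀ x, h x ∈ Set.Icc (0 : ℝ) 1) {T : Finset 𝒯} {τ : 𝒯} (hτ : τ ∉ T) {w : T → ℝ}
    (hw : ∀ t, 0 ≤ w t) (hw1 : ∑ t, w t = 1) :
    ∫ ω, (∑ t, w t * h (X t ω) - posteriorPredictive P X T h τ ω) ^ 2 ∂P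
      ≤ 1 / 4 * ∑ t, w t ^ 2 + ∑ t, w t * biasCoeff d h t τ := by
  refine le_of_forall_pos_le_add fun η hη => ?_
  obtain ⟨A, B, C, hA, hB, hC, hA1, hB1, hAB1, hD, hsq, -, hC1, -, -⟩ :=
    -- The slack `η` is spent as `η / 3` on the second moment and `2 * (η / 3)` on the remainder;
    -- the exponential bounds play no role, so `l = 0`.
    exists_error_decomposition hd hsep hloc hX hh hh1 hτ hw hw1 0 (η := η / 3) (by positivity)
  have hm𝓖 := (measurable_restricted hX T).comap_le
  obtain ⟨hU, hUle⟩ := integral_comp_condExp_le (P := P) hm𝓖 (even_two.convexOn_pow (𝕜 := ℝ))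
    (continuous_pow 2) (hA.add hB) hAB1
  have hUI := (convex_Icc (-1 : ℝ) 1).condExp_mem hm𝓖
    (integrable_of_forall_mem_Icc (μ := P) (hA.add hB) hAB1) isClosed_Icc (ae_of_all _ hAB1)
  have hadd := condExp_add (integrable_of_forall_mem_Icc (μ := P) hA hA1)
    (integrable_of_forall_mem_Icc (μ := P) hB hB1)
    (MeasurableSpace.comap (restricted X T) inferInstance)
  have h1 : ∫ ω, (∑ t, w t * h (X t ω) - posteriorPredictive P X T h τ ω) ^ 2 ∂P
      ≤ ∫ ω, ((P[A + B | MeasurableSpace.comap (restricted X T) inferInstance]) ω ^ 2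
        + 2 * |C ω|) ∂P := by
    refine integral_mono_ae (integrable_sq_error hX hh hh1 τ hw hw1)
      (hU.add (hC.abs.const_mul 2)) ?_
    filter_upwards [hD, hUI, hadd, posteriorPredictive_mem_Icc (P := P) hX hh hh1 T τ]
      with ω hD hUI hadd hR
    have hDI := sub_mem_Icc_neg_one_one
      (sum_mul_mem_Icc hw hw1 fun t => hh1 (X (t : 𝒯) ω)) hR
    rw [Pi.add_apply] at hadd
    rw [← hadd] at hD
    generalize ∑ t, w t * h (X (t : 𝒯) ω) - posteriorPredictive P X T h τ ω = D at hD hDI ⊢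
    generalize (P[A + B | MeasurableSpace.comap (restricted X T) inferInstance]) ω = U
      at hD hUI ⊢
    have h2 : |D + U| ≤ 2 := abs_le.2 ⟨by linarith [hDI.1, hUI.1], by linarith [hDI.2, hUI.2]⟩
    have h3 : D ^ 2 - U ^ 2 = -C ω * (D + U) := by rw [hD]; ring
    have h4 := le_abs_self (-C ω * (D + U))
    rw [abs_mul, abs_neg] at h4
    nlinarith [mul_le_mul_of_nonneg_left h2 (abs_nonneg (C ω))]
  rw [integral_add hU (hC.abs.const_mul 2), integral_const_mul] at h1
  simp only [Pi.add_apply] at hUle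
  linarith

theorem measureReal_error_gt_le (hd : IsPremetric d) (hsep : InfinitelySeparable d)
    (hloc : LocallyExchangeable P X d) (hX : ∀ t, Measurable (X t)) (hh : Measurable h)
    (hh1 : ∀ x, h x ∈ Set.Icc (0 : ℝ) 1) {T : Finset 𝒯} {τ : 𝒯} (hτ : τ ∉ T) {w : T → ℝ}
    (hw : ∀ t, 0 ≤ w t) (hw1 : ∑ t, w t = 1) {δ ε : ℝ} (hε : 0 < ε) (hεδ : ε < δ) :
    P.real {ω | δ < |∑ t, w t * h (X t ω) - posteriorPredictive P X T h τ ω|}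
      ≤ 2 * Real.exp (-(2 * ε ^ 2) / ∑ t, w t ^ 2)
        + (δ - ε)⁻¹ * ∑ t, w t * biasCoeff d h t τ := by
  have hδε : 0 < δ - ε := sub_pos.2 hεδ
  set S : ℝ := ∑ t, w t ^ 2
  set R : Ω → ℝ := posteriorPredictive P X T h τ
  have hS : 0 < S := by
    refine (Finset.sum_nonneg fun t _ => sq_nonneg (w t)).lt_of_ne' fun h0 => ?_
    rw [Finset.sum_eq_zero_iff_of_nonneg fun t _ => sq_nonneg (w t)] at h0
    rw [Finset.sum_eq_zero fun t ht => pow_eq_zero_iff two_ne_zero |>.1 (h0 t ht)] at hw1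
    exact zero_ne_one hw1
  refine le_of_forall_pos_le_add fun η' hη' => ?_
  -- One `η` for each of the two tails, and one each for bias and remainder, both multiplied by `(δ
  -- - ε)⁻¹`.
  let η : ℝ := η' / (2 + 2 * (δ - ε)⁻¹)
  have hη : 0 < η := by positivity
  have hηη' : 2 * η + (δ - ε)⁻¹ * (2 * η) = η' := by
    have : 2 + 2 * (δ - ε)⁻¹ ≠ 0 := by positivity
    calc _ = (2 + 2 * (δ - ε)⁻¹) * η := by ring
      _ = η' := mul_div_cancel₀ _ this
  -- The minimizer of the Chernoff exponent `-l * ε + l ^ 2 * S / 8`, whose minimum is `-2 * ε ^ 2 /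
  -- S`.
  let l : ℝ := 4 * ε / S
  have hl : 0 < l := by positivity
  obtain ⟨A, B, C, hA, hB, hC, hA1, hB1, -, hD, -, hBle, hCle, hexp, hexp'⟩ :=
    exists_error_decomposition hd hsep hloc hX hh hh1 hτ hw hw1 l hη
  have hm𝓖 := (measurable_restricted hX T).comap_le
  set 𝓖 : MeasurableSpace Ω := MeasurableSpace.comap (restricted X T) inferInstance
  have hbound : ∀ I : ℝ, I ≤ Real.exp (l ^ 2 * S / 8) + η →
      Real.exp (-(l * ε)) * I ≤ Real.exp (-(2 * ε ^ 2) / S) + η := fun I hI => by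
    have h1 : Real.exp (-(l * ε)) * Real.exp (l ^ 2 * S / 8) = Real.exp (-(2 * ε ^ 2) / S) := by
      rw [← Real.exp_add]
      congr 1
      simp only [l]
      field_simp
      ring
    have h2 : Real.exp (-(l * ε)) ≤ 1 := Real.exp_le_one_iff.2 (by nlinarith [mul_pos hl hε])
    have h3 := mul_le_mul_of_nonneg_left hI (Real.exp_pos (-(l * ε))).le
    rw [mul_add, h1] at h3
    nlinarith
  have hup : P.real {ω | ε ≤ (P[A | 𝓖]) ω} ≤ Real.exp (-(2 * ε ^ 2) / S) + η :=
    (measureReal_ge_condExp_le hm𝓖 hA hA1 hl.le ε).trans (hbound _ hexp)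
  have hdown : P.real {ω | ε ≤ (P[-A | 𝓖]) ω} ≤ Real.exp (-(2 * ε ^ 2) / S) + η := by
    refine (measureReal_ge_condExp_le hm𝓖 hA.neg (a := -1) (b := 1)
      (fun ω => ⟨neg_le_neg (hA1 ω).2, neg_le.1 (hA1 ω).1⟩) hl.le ε).trans (hbound _ ?_)
    refine le_trans (le_of_eq ?_) hexp'
    refine integral_congr_ae (ae_of_all _ fun ω => ?_)
    simp only [Pi.neg_apply, mul_neg, neg_mul]
  have hrest : P.real {ω | δ - ε ≤ |(P[B | 𝓖]) ω| + |C ω|}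
      ≤ (δ - ε)⁻¹ * (∑ t, w t * biasCoeff d h t τ + 2 * η) := by
    have hi : Integrable (fun ω => |(P[B | 𝓖]) ω| + |C ω|) P :=
      integrable_condExp.abs.add hC.abs
    have h1 := mul_meas_ge_le_integral_of_nonneg
      (ae_of_all P fun ω => by positivity) hi (δ - ε)
    rw [integral_add integrable_condExp.abs hC.abs] at h1
    have h2 := integral_abs_condExp_le (m := 𝓖) (μ := P) B
    rw [inv_mul_eq_div, le_div_iff₀ hδε]
    linarith
  have hsub : P.real {ω | δ < |∑ t, w t * h (X t ω) - R ω|}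
      ≤ P.real ({ω | ε ≤ (P[A | 𝓖]) ω} ∪ {ω | ε ≤ (P[-A | 𝓖]) ω}
        ∪ {ω | δ - ε ≤ |(P[B | 𝓖]) ω| + |C ω|}) := by
    refine ENNReal.toReal_mono (measure_ne_top _ _) (measure_mono_ae ?_)
    filter_upwards [hD, condExp_neg (μ := P) A 𝓖] with ω hD hneg
    intro (hω : δ < |_|)
    change (_ ∨ _) ∨ _
    simp only [Set.mem_ofPred_eq]
    by_contra! hcon
    obtain ⟨⟨h1, h2⟩, h3⟩ := hcon
    rw [hneg, Pi.neg_apply] at h2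
    rw [hD] at hω
    have h4 := abs_sub ((P[A | 𝓖]) ω + (P[B | 𝓖]) ω) (C ω)
    have h5 := abs_add_le ((P[A | 𝓖]) ω) ((P[B | 𝓖]) ω)
    have h6 : |(P[A | 𝓖]) ω| < ε := abs_lt.2 ⟨by linarith, h1⟩
    linarith
  have hun := hsub.trans ((measureReal_union_le _ _).trans
    (add_le_add_left (measureReal_union_le _ _) _))
  rw [mul_add] at hrest
  linarith

end Approximation

end LocalExch

theorem mainTheorem9 {Ω 𝒯 𝒳 : Type*} [MeasurableSpace Ω] [MeasurableSpace 𝒳]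
    [StandardBorelSpace 𝒳] (P : Measure Ω) [IsProbabilityMeasure P]
    (d : 𝒯 → 𝒯 → ℝ) (hd : LocalExch.IsPremetric d) (hsep : LocalExch.InfinitelySeparable d)
    (X : 𝒯 → Ω → 𝒳) (hX : ∀ t, Measurable (X t))
    (hloc : LocalExch.LocallyExchangeable P X d)
    (T : Finset 𝒯) (ξ : 𝒯 → 𝒯 → ℝ)
    (hξ_mem : ∀ t ∈ T, ∀ σ, ξ t σ ∈ Set.Icc (0 : ℝ) 1)
    (hξ_sum : ∀ σ, ∑ t ∈ T, ξ t σ = 1)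
    (h : 𝒳 → ℝ) (hh : Measurable h) (hh_mem : ∀ x, h x ∈ Set.Icc (0 : ℝ) 1)
    (τ : 𝒯) (hτ : τ ∉ T) :
    (Integrable (fun ω => (∫ x, h x ∂(LocalExch.localEmpirical X T ξ τ ω)
        - LocalExch.posteriorPredictive P X T h τ ω) ^ 2) P ∧
      ∫ ω, (∫ x, h x ∂(LocalExch.localEmpirical X T ξ τ ω)
        - LocalExch.posteriorPredictive P X T h τ ω) ^ 2 ∂P
      ≤ 1 / 4 * ∑ t ∈ T, ξ t τ ^ 2 + ∑ t ∈ T, ξ t τ * LocalExch.biasCoeff d h t τ) ∧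
    ∀ δ : ℝ, 0 < δ →
      P.real {ω | δ < |∫ x, h x ∂(LocalExch.localEmpirical X T ξ τ ω)
        - LocalExch.posteriorPredictive P X T h τ ω|}
      ≤ ⨅ ε : Set.Ioo (0 : ℝ) δ,
          (2 * Real.exp (-(2 * (ε : ℝ) ^ 2) / ∑ t ∈ T, ξ t τ ^ 2)
            + (δ - ε)⁻¹ * ∑ t ∈ T, ξ t τ * LocalExch.biasCoeff d h t τ) := by
  have hw : ∀ t : T, 0 ≤ ξ t τ := fun t => (hξ_mem t t.2 τ).1
  have hw1 : ∑ t : T, ξ t τ = 1 := by rw [← hξ_sum τ, ← Finset.sum_coe_sort T]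
  simp only [LocalExch.integral_localEmpirical (X := X) hh fun t ht => (hξ_mem t ht τ).1]
  rw [← Finset.sum_coe_sort T fun t => ξ t τ ^ 2,
    ← Finset.sum_coe_sort T fun t => ξ t τ * LocalExch.biasCoeff d h t τ]
  refine ⟨⟨LocalExch.integrable_sq_error hX hh hh_mem τ hw hw1,
    LocalExch.integral_sq_error_le hd hsep hloc hX hh hh_mem hτ hw hw1⟩, fun δ hδ => ?_⟩
  have : Nonempty (Set.Ioo (0 : ℝ) δ) := ⟨⟨δ / 2, by positivity, by linarith⟩⟩
  exact le_ciInf fun ε =>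
    LocalExch.measureReal_error_gt_le hd hsep hloc hX hh hh_mem hτ hw hw1 ε.2.1 ε.2.2
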